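/- Let $n\ge 1$ and let $P\in\mathbb{C}[X_1^{\pm1},\ldots,X_n^{\pm1}]\smallsetminus\{0\}$ be a Laurent polynomial with exactly $k\ge 2$ non-zero terms. For a non-zero Laurent polynomial $Q$ in $r\ge 1$ variables let $$m(Q)=\int_{[0,1)^r}\log\bigl|Q\bigl(e^{2\pi\sqrt{-1}x_1},\ldots,e^{2\pi\sqrt{-1}x_r}\bigr)\bigr|\,dx_1\cdots dx_r$$ be its logarithmic Mahler measure. For $a=(a_1,\ldots,a_n)\in\mathbb{Z}^n$ let $$\rho(a;\mathbb{Z}^n)=\inf\bigl\{|\omega| : \omega\in\mathbb{Z}^n\smallsetminus\{0\},\ \omega_1a_1+\cdots+\omega_na_n=0\bigr\}\in[1,\infty],$$ where $|\cdot|$ is the maximum norm and $\inf\emptyset=\infty$ (which occurs only if $n=1$ and $a\neq 0$). Then for every $\epsilon>0$ there are constants $C>0$ and $R\ge 0$, depending only on $n$, $P$ and $\epsilon$, such that for every $a\in\mathbb{Z}^n$ with $\rho(a;\mathbb{Z}^n)\ge R$ the one-variable Laurent polynomial $P(X^{a_1},\ldots,X^{a_n})$ is non-zero and $$\bigl|m\bigl(P(X^{a_1},\ldots,X^{a_n})\bigr)-m(P)\bigr|\le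 C\,\rho(a;\mathbb{Z}^n)^{-\frac{1}{4(k-1)}+\epsilon},$$ where both integrals defining the logarithmic Mahler measures converge absolutely. Here $\infty^s=0$ if $s<0$, $\infty^0=1$, and $\infty^s=\infty$ if $s>0$. -/

import Mathlib

open scoped ENNReal NNReal

/-- The ring `ℂ[X₁^{±1}, …, Xₙ^{±1}]` of Laurent polynomials in `n` variables with complex
coefficients: the coefficient of `X₁^{m₁} ⋯ Xₙ^{mₙ}` in `P` is `P.coeff m`. -/
abbrev LaurentPoly (n : ℕ) : Type := AddMonoidAlgebra ℂ (Fin n → ℤ)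

namespace LaurentPoly

/-- The number of non-zero terms of a Laurent polynomial. -/
def numTerms {n : ℕ} (P : LaurentPoly n) : ℕ := P.coeff.support.card

/-- The value `P(z₁, …, zₙ)` (meaningful when all `zᵢ` are non-zero). -/
noncomputable def eval {n : ℕ} (P : LaurentPoly n) (z : Fin n → ℂ) : ℂ :=
  P.coeff.sum fun m c => c * ∏ i, z i ^ m i

/-- The point `e(x) = (e^{2πi x₁}, …, e^{2πi xₙ})`. -/
noncomputable def expPoint {n : ℕ} (x : Fin n → ℝ) : Fin n → ℂ :=
  fun i => Complex.exp (2 * Real.pi * Complex.I * x i)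

/-- The half-open unit cube `[0,1)ⁿ`. -/
def unitCube (n : ℕ) : Set (Fin n → ℝ) := Set.univ.pi fun _ => Set.Ico (0 : ℝ) 1

/-- The function `x ↦ log |P(e(x))|` on `ℝⁿ`. -/
noncomputable def logAbs {n : ℕ} (P : LaurentPoly n) (x : Fin n → ℝ) : ℝ :=
  Real.log ‖P.eval (expPoint x)‖

/-- The logarithmic Mahler measure
`m(P) = ∫_{[0,1)ⁿ} log |P(e^{2πi x₁}, …, e^{2πi xₙ})| dx`, for `P ≠ 0`. -/
noncomputable def logMahler {n : ℕ} (P : LaurentPoly n) : ℝ :=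
  ∫ x in unitCube n, P.logAbs x

/-- The Laurent polynomial `P(X^{a₁}, …, X^{aₙ})` in one variable `X`: each monomial
`X₁^{m₁} ⋯ Xₙ^{mₙ}` is replaced by `X^{m₁ a₁ + ⋯ + mₙ aₙ}`, and terms whose exponents become equal
are collected. -/
noncomputable def substPow {n : ℕ} (P : LaurentPoly n) (a : Fin n → ℤ) : LaurentPoly 1 :=
  AddMonoidAlgebra.mapDomain (fun m (_ : Fin 1) => m ⬝ᵥ a) P

end LaurentPoly

/-- `ρ(a; Ω) = inf { |ω| : ω ∈ Ω ∖ {0}, ⟨ω, a⟩ = 0 }` for a subgroup `Ω` of `ℤⁿ`, where `|·|` is the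
maximum norm. The infimum of the empty set is `∞`. -/
noncomputable def rho {n : ℕ} (a : Fin n → ℤ) (Ω : AddSubgroup (Fin n → ℤ)) : ℝ≥0∞ :=
  sInf {r : ℝ≥0∞ | ∃ ω : Fin n → ℤ, ω ∈ Ω ∧ ω ≠ 0 ∧ ω ⬝ᵥ a = 0 ∧ r = ‖ω‖ₑ}

open MeasureTheory Set

open UnitAddTorus

/-- A function whose derivative is at least `γ` crosses zero at most once, and transversally. -/
lemma exists_crossing_point {f f' : ℝ → ℝ} (hf : ∀ x, HasDerivAt f (f' x) x) {a b γ : ℝ}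
    (hab : a ≤ b) (h : ∀ x ∈ Icc a b, γ ≤ f' x) :
    ∃ c ∈ Icc a b, (∀ x ∈ Ioc c b, γ * (x - c) ≤ f x) ∧ (∀ x ∈ Ico a c, γ * (c - x) ≤ -f x) := by
  have hcont : Continuous f := continuous_iff_continuousAt.2 fun x => (hf x).continuousAt
  have key : ∀ x ∈ Icc a b, ∀ y ∈ Icc a b, x ≤ y → γ * (y - x) ≤ f y - f x :=
    (convex_Icc a b).mul_sub_le_image_sub_of_le_deriv hcont.continuousOn
      (fun x _ => (hf x).differentiableAt.differentiableWithinAt)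
      (fun x hx => by rw [(hf x).deriv]; exact h x (interior_subset hx))
  have ha : a ∈ Icc a b := left_mem_Icc.2 hab
  have hb : b ∈ Icc a b := right_mem_Icc.2 hab
  rcases le_total 0 (f a) with h0 | h0
  · refine ⟨a, ha, fun x hx => ?_, fun x hx => absurd hx.2 (not_lt.2 hx.1)⟩
    linarith [key a ha x (Ioc_subset_Icc_self hx) hx.1.le]
  rcases le_total (f b) 0 with h1 | h1
  · refine ⟨b, hb, fun x hx => absurd hx.1 (not_lt.2 hx.2), fun x hx => ?_⟩
    linarith [key x (Ico_subset_Icc_self hx) b hb hx.2.le]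
  obtain ⟨c, hc, hc0⟩ := intermediate_value_Icc hab hcont.continuousOn ⟨h0, h1⟩
  refine ⟨c, hc, fun x hx => ?_, fun x hx => ?_⟩
  · linarith [key c hc x ⟨hc.1.trans hx.1.le, hx.2⟩ hx.1.le]
  · linarith [key x ⟨hx.1, hx.2.le.trans hc.2⟩ c hc hx.2.le]

/-- Sublevel set estimate: if the `j`-th derivative of `f 0` is at least `γ` on `[a, b]`, then
`f 0` is smaller than `γ r ^ j` only on a set of measure `O(r)`. -/
lemma volume_sublevel_le (j : ℕ) {f : ℕ → ℝ → ℝ} (hf : ∀ i x, HasDerivAt (f i) (f (i + 1) x) x)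
    {a b γ r : ℝ} (hγ : 0 < γ) (hr : 0 ≤ r) (h : ∀ x ∈ Icc a b, γ ≤ f j x) :
    volume {x ∈ Icc a b | |f 0 x| < γ * r ^ j} ≤ ENNReal.ofReal ((2 ^ (j + 1) - 2) * r) := by
  induction j generalizing f a b γ with
  | zero =>
    have : {x ∈ Icc a b | |f 0 x| < γ * r ^ 0} = ∅ := by
      ext x
      simp only [mem_ofPred_eq, mem_empty_iff_false, iff_false, not_and, not_lt, pow_zero, mul_one]
      exact fun hx => (h x hx).trans (le_abs_self _)
    rw [this, measure_empty]
    exact zero_le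
  | succ j ih =>
    rcases lt_or_ge b a with hab | hab
    · simp [Icc_eq_empty (not_le.2 hab)]
    rcases hr.eq_or_lt with rfl | hr
    · have : {x ∈ Icc a b | |f 0 x| < γ * 0 ^ (j + 1)} = ∅ := by
        ext x
        simp
      rw [this, measure_empty]
      exact zero_le
    obtain ⟨c, hc, hc1, hc2⟩ := exists_crossing_point (hf j) hab h
    have h1 := ih (f := f) hf (a := c + r) (b := b) (γ := γ * r) (by positivity)
      (fun x hx => by
        have := hc1 x ⟨by linarith [hx.1], hx.2⟩
        nlinarith [hx.1])
    have h2 := ih (f := fun i x => -f i x) (fun i x => (hf i x).neg) (a := a) (b := c - r)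
      (γ := γ * r) (by positivity)
      (fun x hx => by
        have := hc2 x ⟨hx.1, by linarith [hx.2]⟩
        nlinarith [hx.2])
    have hsub : {x ∈ Icc a b | |f 0 x| < γ * r ^ (j + 1)} ⊆
        ({x ∈ Icc (c + r) b | |f 0 x| < γ * r * r ^ j} ∪
          {x ∈ Icc a (c - r) | |-f 0 x| < γ * r * r ^ j}) ∪ Icc (c - r) (c + r) := by
      rintro x ⟨hx, hlt⟩
      rw [pow_succ', ← mul_assoc] at hlt
      by_cases hx1 : c + r ≤ x
      · exact Or.inl (Or.inl ⟨⟨hx1, hx.2⟩, hlt⟩)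
      by_cases hx2 : x ≤ c - r
      · exact Or.inl (Or.inr ⟨⟨hx.1, hx2⟩, by rwa [abs_neg]⟩)
      · exact Or.inr ⟨by linarith, by linarith⟩
    have h2j : (2 : ℝ) ≤ 2 ^ (j + 1) := by
      rw [pow_succ]
      linarith [one_le_pow₀ (n := j) (one_le_two (α := ℝ))]
    calc _ ≤ _ := measure_mono hsub
      _ ≤ _ := measure_union_le _ _
      _ ≤ _ := add_le_add (measure_union_le _ _) le_rfl
      _ ≤ _ := add_le_add (add_le_add h1 h2) le_rfl
      _ = _ := by
        have h0 : 0 ≤ ((2 : ℝ) ^ (j + 1) - 2) * r := mul_nonneg (by linarith) hr.le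
        rw [Real.volume_Icc, ← ENNReal.ofReal_add h0 h0,
          ← ENNReal.ofReal_add (by linarith) (by linarith)]
        congr 1
        ring

/-- Some derivative of an exponential sum with distinct frequencies is large at the origin. -/
lemma exists_moment_ge {k : ℕ} {l : Fin k → ℂ} (hl : Function.Injective l) :
    ∃ c > 0, ∀ b : Fin k → ℂ, b ≠ 0 → ∃ j : Fin k, c * ‖b‖ ≤ ‖∑ i, b i * l i ^ (j : ℕ)‖ := by
  let F : (Fin k → ℂ) →ₗ[ℂ] (Fin k → ℂ) := Matrix.toLin' (Matrix.vandermonde l).transpose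
  have hF : Function.Injective F := by
    rw [injective_iff_map_eq_zero]
    intro b hb
    refine Matrix.eq_zero_of_mulVec_eq_zero (M := (Matrix.vandermonde l).transpose) ?_ hb
    rw [Matrix.det_transpose]
    exact Matrix.det_vandermonde_ne_zero_iff.2 hl
  obtain ⟨K, hK, hKF⟩ := F.injective_iff_antilipschitz.1 hF
  have hK' : (0 : ℝ) < K := hK
  refine ⟨(K : ℝ)⁻¹, by positivity, fun b hb => ?_⟩
  have h1 : ‖b‖ ≤ K * ‖F b‖ := by simpa using hKF.le_mul_dist b 0
  by_contra! hcon
  have hb' : 0 < (K : ℝ)⁻¹ * ‖b‖ := by positivity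
  have h2 : ‖F b‖ < (K : ℝ)⁻¹ * ‖b‖ := by
    refine (pi_norm_lt_iff hb').2 fun j => ?_
    have : F b j = ∑ i, b i * l i ^ (j : ℕ) := by
      simp [F, Matrix.mulVec, dotProduct, Matrix.vandermonde, mul_comm]
    rw [this]
    exact hcon j
  have : ‖b‖ < ‖b‖ := calc
    ‖b‖ ≤ K * ‖F b‖ := h1
    _ < K * ((K : ℝ)⁻¹ * ‖b‖) := by gcongr
    _ = ‖b‖ := by field_simp
  exact this.false

/-- Sublevel set estimate for exponential sums with given real frequencies on a short interval. -/
lemma exists_expSum_sublevel_le {k : ℕ} {l : Fin k → ℝ} (hl : Function.Injective l) :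
    ∃ L > 0, ∃ c > 0, ∀ b : Fin k → ℂ, b ≠ 0 → ∀ r : ℝ, 0 ≤ r → r ≤ 1 →
      volume {t ∈ Icc 0 L | ‖∑ i, b i * Complex.exp (Complex.I * (l i * t : ℝ))‖ <
        c * ‖b‖ * r ^ (k - 1)} ≤ ENNReal.ofReal (2 ^ k * r) := by
  obtain ⟨c, hc, hcb⟩ := exists_moment_ge (l := fun i => Complex.I * (l i : ℂ))
    (fun i j hij => hl (by simpa using hij))
  set K : ℝ := ∑ j : Fin k, ∑ i, |l i| ^ ((j : ℕ) + 1) with hK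
  have hK0 : 0 ≤ K := by positivity
  refine ⟨c / (2 * (K + 1)), by positivity, c / 2, by positivity, fun b hb r hr hr1 => ?_⟩
  set L := c / (2 * (K + 1)) with hL
  have hKL : K * L ≤ c / 2 := by
    rw [hL, mul_div_assoc', div_le_div_iff₀ (by positivity) (by positivity)]
    nlinarith
  obtain ⟨j, hj⟩ := hcb b hb
  have hb' : 0 < ‖b‖ := norm_pos_iff.2 hb
  set z := ∑ i, b i * (Complex.I * (l i : ℂ)) ^ (j : ℕ) with hz
  have hz0 : 0 < ‖z‖ := lt_of_lt_of_le (by positivity) hj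
  set u : ℂ := (starRingEnd ℂ) z / ‖z‖ with hu
  have hun : ‖u‖ = 1 := by simp [hu, hz0.ne']
  have huz : u * z = ‖z‖ := by
    rw [hu, div_mul_eq_mul_div, mul_comm, Complex.mul_conj, Complex.normSq_eq_norm_sq]
    have : (‖z‖ : ℂ) ≠ 0 := by exact_mod_cast hz0.ne'
    push_cast
    field_simp
  let g : ℕ → ℝ → ℂ := fun n t =>
    ∑ i, b i * ((Complex.I * (l i : ℂ)) ^ n * Complex.exp (Complex.I * (l i * t : ℝ)))
  have hg : ∀ n t, HasDerivAt (g n) (g (n + 1) t) t := by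
    intro n t
    refine HasDerivAt.fun_sum fun i _ => ?_
    refine HasDerivAt.const_mul _ ?_
    rw [pow_succ, mul_assoc]
    refine HasDerivAt.const_mul _ ?_
    have h1 : HasDerivAt (fun t : ℝ => Complex.I * ((l i * t : ℝ) : ℂ)) (Complex.I * (l i : ℂ)) t := by
      have := ((hasDerivAt_id t).const_mul (l i)).ofReal_comp.const_mul Complex.I
      simpa using this
    have := h1.cexp
    rwa [mul_comm] at this
  let f : ℕ → ℝ → ℝ := fun n t => (u * g n t).re
  have hf : ∀ n t, HasDerivAt (f n) (f (n + 1) t) t := fun n t =>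
    Complex.reCLM.hasFDerivAt.comp_hasDerivAt t ((hg n t).const_mul u)
  have hgz : ∀ t ∈ Icc 0 L, ‖g j t - z‖ ≤ ‖b‖ * (c / 2) := by
    intro t ht
    calc ‖g j t - z‖ = ‖∑ i, b i * ((Complex.I * (l i : ℂ)) ^ (j : ℕ) *
          (Complex.exp (Complex.I * (l i * t : ℝ)) - 1))‖ := by
          rw [hz, ← Finset.sum_sub_distrib]
          congr 1
          refine Finset.sum_congr rfl fun i _ => ?_
          ring
      _ ≤ ∑ i, ‖b‖ * (|l i| ^ (j : ℕ) * (|l i| * L)) := by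
          refine norm_sum_le_of_le _ fun i _ => ?_
          rw [norm_mul, norm_mul, norm_pow, norm_mul, Complex.norm_I, one_mul, Complex.norm_real,
            Real.norm_eq_abs]
          have h1 := Real.norm_exp_I_mul_ofReal_sub_one_le (x := l i * t)
          rw [norm_mul, Real.norm_eq_abs, Real.norm_eq_abs, abs_of_nonneg ht.1] at h1
          have h2 : |l i| * t ≤ |l i| * L := by gcongr; exact ht.2
          gcongr
          · exact norm_le_pi_norm b i
          · exact h1.trans h2
      _ = ‖b‖ * ((∑ i, |l i| ^ ((j : ℕ) + 1)) * L) := by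
          rw [Finset.sum_mul, Finset.mul_sum]
          refine Finset.sum_congr rfl fun i _ => ?_
          ring
      _ ≤ ‖b‖ * (K * L) := by
          gcongr
          rw [hK]
          exact Finset.single_le_sum (f := fun j : Fin k => ∑ i, |l i| ^ ((j : ℕ) + 1))
            (fun _ _ => by positivity) (Finset.mem_univ j)
      _ ≤ ‖b‖ * (c / 2) := by gcongr
  have hfj : ∀ t ∈ Icc 0 L, c / 2 * ‖b‖ ≤ f j t := by
    intro t ht
    have h1 : f j t = ‖z‖ + (u * (g j t - z)).re := by
      simp only [f]
      rw [mul_sub, huz, Complex.sub_re, Complex.ofReal_re]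
      ring
    have h2 : |(u * (g j t - z)).re| ≤ ‖b‖ * (c / 2) := by
      refine (Complex.abs_re_le_norm _).trans ?_
      rw [norm_mul, hun, one_mul]
      exact hgz t ht
    rw [h1]
    linarith [neg_abs_le (u * (g j t - z)).re]
  refine le_trans (measure_mono ?_) ((volume_sublevel_le (j : ℕ) hf (by positivity) hr hfj).trans
    (ENNReal.ofReal_le_ofReal ?_))
  · rintro t ⟨ht, hlt⟩
    refine ⟨ht, ?_⟩
    have h1 : |f 0 t| ≤ ‖g 0 t‖ := by
      refine (Complex.abs_re_le_norm _).trans ?_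
      rw [norm_mul, hun, one_mul]
    have h2 : g 0 t = ∑ i, b i * Complex.exp (Complex.I * (l i * t : ℝ)) := by simp [g]
    rw [h2] at h1
    refine h1.trans_lt (hlt.trans_le ?_)
    gcongr ?_ * ?_
    exact pow_le_pow_of_le_one hr hr1 (by have := j.2; omega)
  · gcongr
    have : (2 : ℝ) ^ ((j : ℕ) + 1) ≤ 2 ^ k := by
      gcongr
      · norm_num
      · exact j.2
    linarith

instance : IsProbabilityMeasure (volume : Measure UnitAddCircle) := ⟨UnitAddCircle.measure_univ⟩

instance (n : ℕ) : IsProbabilityMeasure (volume : Measure (UnitAddTorus (Fin n))) :=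
  inferInstanceAs (IsProbabilityMeasure (Measure.pi fun _ : Fin n => (volume : Measure UnitAddCircle)))

/-- The projection `ℝⁿ → (ℝ / ℤ)ⁿ`. -/
def torusMk {n : ℕ} (x : Fin n → ℝ) : UnitAddTorus (Fin n) := fun i => (x i : UnitAddCircle)

lemma measurable_torusMk {n : ℕ} : Measurable (torusMk (n := n)) :=
  measurable_pi_lambda _ fun i => AddCircle.measurable_mk'.comp (measurable_pi_apply i)

lemma fourier_coe_unit (m : ℤ) (x : ℝ) :
    fourier m (x : UnitAddCircle) = Complex.exp (2 * Real.pi * Complex.I * m * x) := by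
  rw [fourier_coe_apply]
  simp

lemma mFourier_torusMk {n : ℕ} (m : Fin n → ℤ) (x : Fin n → ℝ) :
    mFourier m (torusMk x) = Complex.exp (2 * Real.pi * Complex.I * ∑ i, m i * x i) := by
  simp only [mFourier, torusMk, ContinuousMap.coe_mk, fourier_coe_unit]
  push_cast
  rw [← Complex.exp_sum, Finset.mul_sum]
  congr 1
  exact Finset.sum_congr rfl fun i _ => by ring

lemma mFourier_apply_add {n : ℕ} (m : Fin n → ℤ) (x y : UnitAddTorus (Fin n)) :
    mFourier m (x + y) = mFourier m x * mFourier m y := by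
  simp [mFourier, fourier_apply, smul_add, AddCircle.toCircle_add, Finset.prod_mul_distrib]

lemma norm_mFourier_apply {n : ℕ} (m : Fin n → ℤ) (x : UnitAddTorus (Fin n)) :
    ‖mFourier m x‖ = 1 := by
  simp only [mFourier, fourier_apply, ContinuousMap.coe_mk, norm_prod, Circle.norm_coe,
    Finset.prod_const_one]

/-- If every orbit segment of a one-parameter flow meets `E` in a set of length at most `ε`, then
`E` has measure at most `ε / L`. -/
lemma measure_mul_le_of_flow {G : Type*} [AddCommGroup G] [MeasurableSpace G] [MeasurableAdd₂ G]
    (μ : Measure G) [IsProbabilityMeasure μ] [μ.IsAddLeftInvariant] {τ : ℝ → G} (hτ : Measurable τ)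
    {E : Set G} (hE : MeasurableSet E) {L : ℝ} {ε : ℝ≥0∞}
    (h : ∀ x, volume {t ∈ Icc 0 L | x + τ t ∈ E} ≤ ε) : μ E * ENNReal.ofReal L ≤ ε := by
  have hmeas : Measurable (Function.uncurry fun (t : ℝ) (x : G) => E.indicator (1 : G → ℝ≥0∞) (x + τ t)) :=
    (measurable_one.indicator hE).comp (measurable_snd.add (hτ.comp measurable_fst))
  calc μ E * ENNReal.ofReal L
      = ∫⁻ t : ℝ in Icc 0 L, (∫⁻ x, E.indicator (1 : G → ℝ≥0∞) (x + τ t) ∂μ) := by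
        have : ∀ t, ∫⁻ x, E.indicator (1 : G → ℝ≥0∞) (x + τ t) ∂μ = μ E := fun t => by
          rw [lintegral_add_right_eq_self, lintegral_indicator_one hE]
        simp [this]
    _ = ∫⁻ x, (∫⁻ t : ℝ in Icc 0 L, E.indicator (1 : G → ℝ≥0∞) (x + τ t)) ∂μ :=
        lintegral_lintegral_swap hmeas.aemeasurable
    _ ≤ ∫⁻ _, ε ∂μ := by
        refine lintegral_mono fun x => ?_
        have hS : MeasurableSet {t | x + τ t ∈ E} := (measurable_const.add hτ) hE
        have : (fun t => E.indicator (1 : G → ℝ≥0∞) (x + τ t)) =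
            {t | x + τ t ∈ E}.indicator 1 := by
          ext t
          simp [indicator]
        rw [this, lintegral_indicator_one hS, Measure.restrict_apply hS, inter_comm]
        exact h x
    _ = ε := by simp

/-- A linear form on `ℝⁿ` separating finitely many lattice points. -/
lemma exists_separating_direction {n : ℕ} (s : Finset (Fin n → ℤ)) :
    ∃ v : Fin n → ℝ, InjOn (fun m : Fin n → ℤ => ∑ i, (m i : ℝ) * v i) s := by
  let ι := {p : s × s // p.1 ≠ p.2}
  obtain ⟨f, hf⟩ := Module.exists_dual_forall_apply_ne_zero (K := ℝ)
    (fun (p : ι) (i : Fin n) => ((p.1.1 : Fin n → ℤ) i : ℝ) - (p.1.2 : Fin n → ℤ) i) (by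
      rintro ⟨⟨p, q⟩, hpq⟩ h0
      refine hpq (Subtype.ext (funext fun i => ?_))
      have := congrFun h0 i
      simp only [Pi.zero_apply, sub_eq_zero] at this
      exact_mod_cast this)
  have hfv : ∀ w : Fin n → ℝ, f w = ∑ i, w i * f (Pi.single i 1) := fun w => by
    rw [LinearMap.pi_apply_eq_sum_univ f w]
    refine Finset.sum_congr rfl fun i _ => ?_
    rw [smul_eq_mul]
    congr 2
    ext j
    simp [Pi.single_apply, eq_comm]
  refine ⟨fun i => f (Pi.single i 1), fun m hm m' hm' h => ?_⟩
  by_contra hne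
  refine hf ⟨⟨⟨m, hm⟩, ⟨m', hm'⟩⟩, fun h => hne (congrArg Subtype.val h)⟩ ?_
  rw [hfv]
  simp only [sub_mul, Finset.sum_sub_distrib]
  exact sub_eq_zero.2 h

/-- Sublevel set estimate for a trigonometric polynomial with `k` terms on a torus. -/
lemma exists_torus_sublevel_le {n : ℕ} (s : Finset (Fin n → ℤ)) (c : (Fin n → ℤ) → ℂ)
    (hc : ∀ m ∈ s, c m ≠ 0) (hs : 2 ≤ s.card) :
    ∃ C > 0, ∀ δ > 0, volume {x : UnitAddTorus (Fin n) | ‖∑ m ∈ s, c m * mFourier m x‖ < δ} ≤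
      ENNReal.ofReal (C * δ ^ ((s.card : ℝ) - 1)⁻¹) := by
  obtain ⟨v, hv⟩ := exists_separating_direction s
  let e : Fin s.card ≃ s := s.equivFin.symm
  let l : Fin s.card → ℝ := fun j => 2 * Real.pi * ∑ i, ((e j : Fin n → ℤ) i : ℝ) * v i
  have hl : Function.Injective l := by
    intro j j' h
    have h1 := mul_left_cancel₀ (by positivity) h
    exact e.injective (Subtype.ext (hv (e j).2 (e j').2 h1))
  obtain ⟨L, hL, γ, hγ, hLγ⟩ := exists_expSum_sublevel_le hl
  let b₀ : Fin s.card → ℂ := fun j => c (e j)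
  have hb₀ : b₀ ≠ 0 := fun h => hc _ (e ⟨0, by omega⟩).2 (congrFun h ⟨0, by omega⟩)
  have hbn : 0 < ‖b₀‖ := norm_pos_iff.2 hb₀
  let τ : ℝ → UnitAddTorus (Fin n) := fun t => torusMk (t • v)
  have hτ : Measurable τ := measurable_torusMk.comp (by fun_prop)
  have hmeas : ∀ δ : ℝ, MeasurableSet {x : UnitAddTorus (Fin n) | ‖∑ m ∈ s, c m * mFourier m x‖ < δ} :=
    fun δ => (isOpen_lt (by fun_prop) continuous_const).measurableSet
  have hk : 0 < (s.card : ℝ) - 1 := by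
    have : (2 : ℝ) ≤ s.card := by exact_mod_cast hs
    linarith
  have key : ∀ r : ℝ, 0 ≤ r → r ≤ 1 →
      volume {x : UnitAddTorus (Fin n) | ‖∑ m ∈ s, c m * mFourier m x‖ < γ * ‖b₀‖ * r ^ (s.card - 1)} ≤
        ENNReal.ofReal (2 ^ s.card / L * r) := by
    intro r hr hr1
    have := measure_mul_le_of_flow volume hτ (hmeas (γ * ‖b₀‖ * r ^ (s.card - 1))) (L := L)
      (ε := ENNReal.ofReal (2 ^ s.card * r)) (fun x => by
        let b : Fin s.card → ℂ := fun j => c (e j) * mFourier (e j : Fin n → ℤ) x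
        have hbb : ‖b‖ = ‖b₀‖ := by
          simp only [Pi.norm_def]
          congr 2
          ext j
          simp [b, b₀, norm_mFourier_apply]
        have hb : b ≠ 0 := norm_pos_iff.1 (hbb ▸ hbn)
        refine le_trans (measure_mono ?_) (hLγ b hb r hr hr1)
        rintro t ⟨ht, hlt⟩
        refine ⟨ht, ?_⟩
        rw [hbb]
        refine lt_of_eq_of_lt ?_ hlt
        rw [← Finset.sum_coe_sort s, ← e.sum_comp]
        congr 1
        refine Finset.sum_congr rfl fun j _ => ?_
        rw [mFourier_apply_add, mFourier_torusMk, ← mul_assoc]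
        simp only [b, l, Pi.smul_apply, smul_eq_mul]
        congr 2
        push_cast
        simp only [Finset.mul_sum, Finset.sum_mul]
        exact Finset.sum_congr rfl fun i _ => by ring)
    have hL' : ENNReal.ofReal L ≠ 0 := by simpa using hL
    rw [← ENNReal.le_div_iff_mul_le (Or.inl hL') (Or.inl ENNReal.ofReal_ne_top),
      ← ENNReal.ofReal_div_of_pos hL] at this
    refine this.trans (ENNReal.ofReal_le_ofReal (le_of_eq ?_))
    ring
  have hD : 0 < γ * ‖b₀‖ := by positivity
  set D := γ * ‖b₀‖
  set p := ((s.card : ℝ) - 1)⁻¹ with hp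
  have hp0 : 0 < p := inv_pos.2 hk
  refine ⟨max 1 (2 ^ s.card / L) * (1 / D) ^ p, by positivity, fun δ hδ => ?_⟩
  rw [mul_assoc, ← Real.mul_rpow (by positivity) hδ.le]
  set r := (1 / D * δ) ^ p with hr
  have hr0 : 0 ≤ r := by positivity
  rcases le_total r 1 with h1 | h1
  · have h2 := key r hr0 h1
    have h3 : D * r ^ (s.card - 1) = δ := by
      rw [hr, ← Real.rpow_natCast, ← Real.rpow_mul (by positivity), Nat.cast_sub (by omega),
        Nat.cast_one, hp, inv_mul_cancel₀ hk.ne', Real.rpow_one]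
      field_simp
    rw [h3] at h2
    refine h2.trans (ENNReal.ofReal_le_ofReal ?_)
    gcongr
    exact le_max_right _ _
  · refine prob_le_one.trans ?_
    rw [← ENNReal.ofReal_one]
    refine ENNReal.ofReal_le_ofReal ?_
    nlinarith [le_max_left (1 : ℝ) (2 ^ s.card / L)]

/-- The square of the measure of `E` is the average measure of `E ∩ (E - h)`. -/
lemma measure_mul_self_eq_lintegral_inter {G : Type*} [AddCommGroup G] [MeasurableSpace G]
    [MeasurableAdd₂ G] (μ : Measure G) [IsProbabilityMeasure μ] [μ.IsAddLeftInvariant]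
    {E : Set G} (hE : MeasurableSet E) :
    μ E * μ E = ∫⁻ h, μ {x | x ∈ E ∧ x + h ∈ E} ∂μ := by
  have hm : Measurable (E.indicator (1 : G → ℝ≥0∞)) := measurable_one.indicator hE
  have hmeas : Measurable (Function.uncurry fun (h x : G) =>
      E.indicator (1 : G → ℝ≥0∞) x * E.indicator (1 : G → ℝ≥0∞) (x + h)) :=
    (hm.comp measurable_snd).mul (hm.comp (measurable_snd.add measurable_fst))
  have h1 : ∀ h, μ {x | x ∈ E ∧ x + h ∈ E} =
      ∫⁻ x, E.indicator (1 : G → ℝ≥0∞) x * E.indicator (1 : G → ℝ≥0∞) (x + h) ∂μ := by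
    intro h
    have hS : MeasurableSet {x | x ∈ E ∧ x + h ∈ E} :=
      hE.inter ((measurable_id.add measurable_const) hE)
    rw [← lintegral_indicator_one hS]
    refine lintegral_congr fun x => ?_
    by_cases hx : x ∈ E <;> by_cases hxh : x + h ∈ E <;> simp [indicator, hx, hxh]
  simp_rw [h1]
  rw [lintegral_lintegral_swap hmeas.aemeasurable]
  have h2 : ∀ x, ∫⁻ h, E.indicator (1 : G → ℝ≥0∞) x * E.indicator (1 : G → ℝ≥0∞) (x + h) ∂μ =
      E.indicator (1 : G → ℝ≥0∞) x * μ E := by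
    intro x
    rw [lintegral_const_mul (f := fun h => E.indicator (1 : G → ℝ≥0∞) (x + h)) _
      (hm.comp (measurable_const.add measurable_id)), lintegral_add_left_eq_self, lintegral_indicator_one hE]
  simp_rw [h2]
  rw [lintegral_mul_const _ hm, lintegral_indicator_one hE]

/-- Sublevel set estimate for sums of `k + 1` characters on a compact group. The constants depend
only on `k` and on how well the characters are separated. -/
theorem exists_character_sublevel_le {G ι : Type*} [AddCommGroup G] [MeasurableSpace G]
    [MeasurableAdd₂ G] (μ : Measure G) [IsProbabilityMeasure μ] [μ.IsAddLeftInvariant]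
    {K : ℝ} (hK : 0 < K) (k : ℕ) :
    ∃ σ : ℝ, 0 < σ ∧ σ ≤ 1 ∧ ∃ C : ℝ, 1 ≤ C ∧ ∀ (χ : ι → G → ℂ) (s : Finset ι),
      s.card = k + 1 → (∀ i ∈ s, Measurable (χ i)) → (∀ i ∈ s, ∀ x y, χ i (x + y) = χ i x * χ i y) →
      (∀ i ∈ s, ∀ x, ‖χ i x‖ = 1) →
      (∀ i ∈ s, ∀ j ∈ s, i ≠ j → ∀ η > 0, μ {x | ‖χ i x - χ j x‖ < η} ≤ ENNReal.ofReal (K * η)) →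
      ∀ c : ι → ℂ, (∀ i ∈ s, 1 ≤ ‖c i‖) → ∀ δ > 0,
        μ {x | ‖∑ i ∈ s, c i * χ i x‖ < δ} ≤ ENNReal.ofReal (C * δ ^ σ) := by
  classical
  have triv : ∀ {C δ σ : ℝ}, 1 ≤ C → 1 ≤ δ → 0 < σ → ∀ S : Set G, μ S ≤ ENNReal.ofReal (C * δ ^ σ) := by
    intro C δ σ hC hδ hσ S
    refine prob_le_one.trans ?_
    rw [← ENNReal.ofReal_one]
    exact ENNReal.ofReal_le_ofReal (one_le_mul_of_one_le_of_one_le hC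
      (Real.one_le_rpow hδ hσ.le))
  induction k with
  | zero =>
    refine ⟨1, one_pos, le_rfl, 1, le_rfl, fun χ s hs _ _ hn _ c hc δ hδ => ?_⟩
    rcases le_or_gt 1 δ with h1 | h1
    · exact triv le_rfl h1 one_pos _
    obtain ⟨i, rfl⟩ := Finset.card_eq_one.1 hs
    have : {x | ‖∑ i ∈ {i}, c i * χ i x‖ < δ} = ∅ := by
      ext x
      simp only [Finset.sum_singleton, norm_mul, hn i (by simp), mul_one, mem_ofPred_eq,
        mem_empty_iff_false, iff_false, not_lt]
      exact h1.le.trans (hc i (by simp))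
    rw [this, measure_empty]
    exact zero_le
  | succ k ih =>
    obtain ⟨σ, hσ, hσ1, C, hC, ih⟩ := ih
    set M : ℝ := (k + 1) * K + 2 * C with hM
    have hM1 : 1 ≤ M := by
      have : 0 ≤ ((k : ℝ) + 1) * K := by positivity
      linarith
    refine ⟨σ / 4, by positivity, by linarith, M, hM1, fun χ s hs hm ha hn hsep c hc δ hδ => ?_⟩
    rcases le_or_gt 1 δ with h1 | h1
    · exact triv hM1 h1 (by positivity) _
    obtain ⟨j, hj⟩ : s.Nonempty := Finset.card_pos.1 (by omega)
    set s' := s.erase j with hs'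
    have hs'c : s'.card = k + 1 := by rw [hs', Finset.card_erase_of_mem hj]; omega
    have hss : ∀ i ∈ s', i ∈ s := fun i hi => Finset.mem_of_mem_erase hi
    set E := {x | ‖∑ i ∈ s, c i * χ i x‖ < δ} with hEdef
    have hE : MeasurableSet E :=
      measurableSet_lt (Finset.measurable_fun_sum s fun i hi => (hm i hi).const_mul (c i)).norm
        measurable_const
    set η := δ ^ (1 / 2 : ℝ) with hη
    have hη0 : 0 < η := by positivity
    set B : Set G := ⋃ i ∈ s', {x | ‖χ i x - χ j x‖ < η} with hB
    have hBm : MeasurableSet B := Finset.measurableSet_biUnion _ fun i hi =>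
      measurableSet_lt ((hm i (hss i hi)).sub (hm j hj)).norm measurable_const
    have hBμ : μ B ≤ ENNReal.ofReal ((k + 1) * K * η) := by
      calc μ B ≤ ∑ i ∈ s', μ {x | ‖χ i x - χ j x‖ < η} := measure_biUnion_finset_le _ _
        _ ≤ ∑ i ∈ s', ENNReal.ofReal (K * η) := Finset.sum_le_sum fun i hi =>
            hsep i (hss i hi) j hj (Finset.ne_of_mem_erase hi) η hη0
        _ = ENNReal.ofReal ((k + 1) * K * η) := by
            rw [Finset.sum_const, hs'c, ← ENNReal.ofReal_nsmul, nsmul_eq_mul, mul_assoc]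
            push_cast
            rfl
    have hdiff : ∀ h x, (∑ i ∈ s, c i * χ i (x + h)) - χ j h * ∑ i ∈ s, c i * χ i x =
        ∑ i ∈ s', c i * (χ i h - χ j h) * χ i x := by
      intro h x
      rw [Finset.mul_sum, ← Finset.sum_sub_distrib, ← Finset.sum_erase_add _ _ hj]
      rw [ha j hj, show c j * (χ j x * χ j h) - χ j h * (c j * χ j x) = 0 by ring, add_zero]
      refine Finset.sum_congr rfl fun i hi => ?_
      rw [ha i (hss i hi)]
      ring
    have hgood : ∀ h, h ∉ B → μ {x | x ∈ E ∧ x + h ∈ E} ≤ ENNReal.ofReal (C * (2 * δ / η) ^ σ) := by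
      intro h hh
      have hge : ∀ i ∈ s', η ≤ ‖χ i h - χ j h‖ := by
        intro i hi
        by_contra hcon
        exact hh (mem_biUnion hi (not_le.1 hcon))
      refine le_trans (measure_mono ?_) (ih χ s' hs'c (fun i hi => hm i (hss i hi))
        (fun i hi => ha i (hss i hi)) (fun i hi => hn i (hss i hi))
        (fun i hi i' hi' => hsep i (hss i hi) i' (hss i' hi'))
        (fun i => c i * (χ i h - χ j h) / η) (fun i hi => ?_) (2 * δ / η) (by positivity))
      · rintro x ⟨hx1, hx2⟩
        have h2 : ∑ i ∈ s', c i * (χ i h - χ j h) / η * χ i x =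
            (∑ i ∈ s', c i * (χ i h - χ j h) * χ i x) / η := by
          rw [Finset.sum_div]
          exact Finset.sum_congr rfl fun i _ => by ring
        change ‖∑ i ∈ s', c i * (χ i h - χ j h) / η * χ i x‖ < 2 * δ / η
        rw [h2, ← hdiff, norm_div, Complex.norm_real, Real.norm_of_nonneg hη0.le]
        gcongr
        refine (norm_sub_le _ _).trans_lt ?_
        rw [norm_mul, hn j hj, one_mul, two_mul]
        exact add_lt_add hx2 hx1
      · rw [norm_div, Complex.norm_real, Real.norm_of_nonneg hη0.le, norm_mul, le_div_iff₀ hη0]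
        exact mul_le_mul (hc i (hss i hi)) (hge i hi) hη0.le (norm_nonneg _)
    have hsq : μ E * μ E ≤ ENNReal.ofReal (M * δ ^ (σ / 4)) * ENNReal.ofReal (M * δ ^ (σ / 4)) := by
      calc μ E * μ E = ∫⁻ h, μ {x | x ∈ E ∧ x + h ∈ E} ∂μ :=
            measure_mul_self_eq_lintegral_inter μ hE
        _ ≤ ∫⁻ h, (B.indicator 1 h + ENNReal.ofReal (C * (2 * δ / η) ^ σ)) ∂μ := by
            refine lintegral_mono fun h => ?_
            by_cases hh : h ∈ B
            · simp only [indicator_of_mem hh, Pi.one_apply]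
              exact prob_le_one.trans le_self_add
            · exact (hgood h hh).trans le_add_self
        _ = μ B + ENNReal.ofReal (C * (2 * δ / η) ^ σ) := by
            rw [lintegral_add_right _ measurable_const, lintegral_indicator_one hBm]
            simp
        _ ≤ ENNReal.ofReal ((k + 1) * K * η + C * (2 * δ / η) ^ σ) := by
            rw [ENNReal.ofReal_add (by positivity) (by positivity)]
            gcongr
        _ ≤ ENNReal.ofReal (M * δ ^ (σ / 4) * (M * δ ^ (σ / 4))) := by
            refine ENNReal.ofReal_le_ofReal ?_
            have e1 : δ ^ (σ / 4) * δ ^ (σ / 4) = δ ^ (σ / 2) := by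
              rw [← Real.rpow_add hδ]; congr 1; ring
            have e2 : η ≤ δ ^ (σ / 2) :=
              Real.rpow_le_rpow_of_exponent_ge hδ h1.le (by linarith)
            have e3 : (2 * δ / η) ^ σ ≤ 2 * δ ^ (σ / 2) := by
              have : 2 * δ / η = 2 * δ ^ (1 / 2 : ℝ) := by
                rw [div_eq_iff hη0.ne', mul_assoc, hη, ← Real.rpow_add hδ]
                norm_num
              rw [this, Real.mul_rpow (by norm_num) (by positivity), ← Real.rpow_mul hδ.le,
                show 1 / 2 * σ = σ / 2 by ring]
              gcongr
              calc (2 : ℝ) ^ σ ≤ 2 ^ (1 : ℝ) :=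
                    Real.rpow_le_rpow_of_exponent_le (by norm_num) hσ1
                _ = 2 := Real.rpow_one 2
            calc (k + 1) * K * η + C * (2 * δ / η) ^ σ
                ≤ (k + 1) * K * δ ^ (σ / 2) + C * (2 * δ ^ (σ / 2)) := by gcongr
              _ = 1 * M * δ ^ (σ / 2) := by rw [hM]; ring
              _ ≤ M * M * δ ^ (σ / 2) := by gcongr
              _ = M * δ ^ (σ / 4) * (M * δ ^ (σ / 4)) := by rw [← e1]; ring
        _ = _ := ENNReal.ofReal_mul (by positivity)
    by_contra! hcon
    exact absurd hsq (not_le.2 (ENNReal.mul_lt_mul hcon hcon))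

/-- The distance between two distinct characters of `ℝ / ℤ` is rarely small. -/
lemma exists_character_separation : ∃ K > 0, ∀ l l' : Fin 1 → ℤ, l ≠ l' → ∀ η > 0,
    volume {x : UnitAddTorus (Fin 1) | ‖mFourier l x - mFourier l' x‖ < η} ≤
      ENNReal.ofReal (K * η) := by
  have h01 : (1 : Fin 1 → ℤ) ≠ 0 := one_ne_zero
  obtain ⟨K, hK, hKη⟩ := exists_torus_sublevel_le (n := 1) {1, 0}
    (fun m => if m = 0 then -1 else 1) (fun m _ => by split_ifs <;> simp)
    (by rw [Finset.card_pair h01])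
  refine ⟨K, hK, fun l l' hll η hη => ?_⟩
  have hw : l 0 - l' 0 ≠ 0 := fun h => hll (by
    ext i
    rw [Subsingleton.elim i 0]
    linarith)
  have hmp : MeasurePreserving (fun x : UnitAddTorus (Fin 1) => (l 0 - l' 0) • x) volume volume := by
    have h1 := volume_preserving_pi (α' := fun _ : Fin 1 => UnitAddCircle)
      (β' := fun _ : Fin 1 => UnitAddCircle) (f := fun _ x => (l 0 - l' 0) • x)
      (fun _ => Measure.measurePreserving_zsmul volume hw)
    exact h1
  have hset : {x : UnitAddTorus (Fin 1) | ‖mFourier l x - mFourier l' x‖ < η} =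
      (fun x : UnitAddTorus (Fin 1) => (l 0 - l' 0) • x) ⁻¹'
        {x | ‖∑ m ∈ ({1, 0} : Finset (Fin 1 → ℤ)), (if m = 0 then (-1 : ℂ) else 1) * mFourier m x‖ < η} := by
    ext x
    have h2 : mFourier l x = mFourier l' x * mFourier 1 ((l 0 - l' 0) • x) := by
      have : mFourier (1 : Fin 1 → ℤ) ((l 0 - l' 0) • x) = mFourier (l - l') x := by
        simp [mFourier, fourier_apply]
      rw [this, ← mFourier_add]
      simp
    simp only [mem_ofPred_eq, mem_preimage]
    rw [Finset.sum_pair h01, if_neg h01, if_pos rfl, mFourier_zero, h2]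
    have h3 : mFourier l' x * mFourier 1 ((l 0 - l' 0) • x) - mFourier l' x =
      mFourier l' x * (1 * mFourier 1 ((l 0 - l' 0) • x) + -1 * 1) := by ring
    rw [h3, norm_mul, norm_mFourier_apply, one_mul]
    rfl
  rw [hset, hmp.measure_preimage]
  · refine (hKη η hη).trans (le_of_eq ?_)
    rw [Finset.card_pair h01]
    norm_num
  · exact ((isOpen_lt (by fun_prop) continuous_const).measurableSet).nullMeasurableSet

/-- A power bound on the measure of sublevel sets bounds small negative moments. -/
lemma exists_integral_rpow_neg_le {Ω : Type*} [MeasurableSpace Ω] (μ : Measure Ω)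
    [IsProbabilityMeasure μ] {C s q : ℝ} (hC : 0 < C) (hq : 0 < q) (hqs : q < s) :
    ∃ D : ℝ, 0 ≤ D ∧ ∀ f : Ω → ℝ, Measurable f → (∀ x, 0 ≤ f x) →
      (∀ δ > 0, μ {x | f x < δ} ≤ ENNReal.ofReal (C * δ ^ s)) →
      (∀ᵐ x ∂μ, 0 < f x) ∧ Integrable (fun x => f x ^ (-q)) μ ∧ ∫ x, f x ^ (-q) ∂μ ≤ D := by
  set A : ℝ≥0∞ := ENNReal.ofReal q * ((∫⁻ t in Ioc (0 : ℝ) 1, ENNReal.ofReal (t ^ (q - 1))) +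
    ∫⁻ t in Ioi (1 : ℝ), ENNReal.ofReal (C * t ^ (q - s - 1))) with hA
  have hAtop : A ≠ ∞ := by
    refine ENNReal.mul_ne_top ENNReal.ofReal_ne_top (ENNReal.add_ne_top.2 ⟨?_, ?_⟩)
    · have h1 : IntegrableOn (fun t : ℝ => t ^ (q - 1)) (Ioc 0 1) :=
        (intervalIntegrable_iff_integrableOn_Ioc_of_le zero_le_one).1
          (intervalIntegral.intervalIntegrable_rpow' (by linarith))
      exact h1.lintegral_lt_top.ne
    · have h1 : IntegrableOn (fun t : ℝ => C * t ^ (q - s - 1)) (Ioi 1) :=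
        (integrableOn_Ioi_rpow_of_lt (by linarith) one_pos).const_mul C
      exact h1.lintegral_lt_top.ne
  refine ⟨A.toReal, ENNReal.toReal_nonneg, fun f hf hf0 h => ?_⟩
  have hpos : ∀ᵐ x ∂μ, 0 < f x := by
    rw [ae_iff]
    refine le_antisymm (ge_of_tendsto (x := nhdsWithin (0 : ℝ) (Ioi 0))
      (f := fun δ : ℝ => ENNReal.ofReal (C * δ ^ s)) ?_ ?_) zero_le
    · have h1 : Filter.Tendsto (fun δ : ℝ => ENNReal.ofReal (C * δ ^ s)) (nhds 0)
          (nhds (ENNReal.ofReal (C * 0 ^ s))) :=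
        ENNReal.tendsto_ofReal (((Real.continuousAt_rpow_const 0 s (Or.inr (by linarith))).tendsto).const_mul C)
      rw [Real.zero_rpow (by linarith), mul_zero, ENNReal.ofReal_zero] at h1
      exact h1.mono_left nhdsWithin_le_nhds
    · filter_upwards [self_mem_nhdsWithin] with δ hδ
      refine (measure_mono fun x hx => ?_).trans (h δ hδ)
      exact (not_lt.1 hx).trans_lt hδ
  have hlin : ∫⁻ x, ENNReal.ofReal ((f x)⁻¹ ^ q) ∂μ ≤ A := by
    rw [lintegral_rpow_eq_lintegral_meas_lt_mul μ (f := fun x => (f x)⁻¹)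
      (Filter.Eventually.of_forall fun x => inv_nonneg.2 (hf0 x)) hf.inv.aemeasurable hq, hA]
    gcongr
    rw [← Ioc_union_Ioi_eq_Ioi (zero_le_one' ℝ),
      lintegral_union measurableSet_Ioi (Ioc_disjoint_Ioi le_rfl)]
    refine add_le_add (lintegral_mono fun t => ?_) (setLIntegral_mono' measurableSet_Ioi fun t ht => ?_)
    · exact mul_le_of_le_one_left zero_le prob_le_one
    · have ht0 : (0 : ℝ) < t := one_pos.trans ht
      calc μ {x | t < (f x)⁻¹} * ENNReal.ofReal (t ^ (q - 1))
          ≤ ENNReal.ofReal (C * (t⁻¹) ^ s) * ENNReal.ofReal (t ^ (q - 1)) := by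
            gcongr
            refine (measure_mono fun x hx => ?_).trans (h t⁻¹ (inv_pos.2 ht0))
            have hfx : 0 < f x := by
              rcases (hf0 x).eq_or_lt with h0 | h0
              · have hx' : t < (f x)⁻¹ := hx
                rw [← h0, inv_zero] at hx'
                exact absurd hx' (not_lt.2 ht0.le)
              · exact h0
            exact (lt_inv_comm₀ ht0 hfx).1 hx
        _ = ENNReal.ofReal (C * t ^ (q - s - 1)) := by
            rw [← ENNReal.ofReal_mul (by positivity), mul_assoc, Real.inv_rpow ht0.le,
              ← Real.rpow_neg ht0.le, ← Real.rpow_add ht0]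
            congr 3
            ring
  have heq : (fun x => f x ^ (-q)) = fun x => (f x)⁻¹ ^ q := by
    ext x
    rw [Real.rpow_neg (hf0 x), Real.inv_rpow (hf0 x)]
  have hnn : ∀ x, 0 ≤ (f x)⁻¹ ^ q := fun x => Real.rpow_nonneg (inv_nonneg.2 (hf0 x)) _
  have hmeas : AEStronglyMeasurable (fun x => (f x)⁻¹ ^ q) μ :=
    (hf.inv.pow_const q).aestronglyMeasurable
  refine ⟨hpos, ?_, ?_⟩
  · rw [heq]
    refine ⟨hmeas, ?_⟩
    rw [hasFiniteIntegral_iff_ofReal (Filter.Eventually.of_forall hnn)]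
    exact hlin.trans_lt (lt_top_iff_ne_top.2 hAtop)
  · rw [heq, integral_eq_lintegral_of_nonneg_ae (Filter.Eventually.of_forall hnn) hmeas]
    exact ENNReal.toReal_mono hAtop hlin

lemma log_one_add_le_rpow_div {z p : ℝ} (hz : 0 ≤ z) (hp : 0 < p) (hp1 : p ≤ 1) :
    Real.log (1 + z) ≤ z ^ p / p := by
  rw [le_div_iff₀ hp, mul_comm, ← Real.log_rpow (by linarith)]
  calc Real.log ((1 + z) ^ p) ≤ (1 + z) ^ p - 1 := Real.log_le_sub_one_of_pos (by positivity)
    _ ≤ (1 ^ p + z ^ p) - 1 := by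
        gcongr
        exact Real.rpow_add_le_add_rpow zero_le_one hz hp.le hp1
    _ = z ^ p := by rw [Real.one_rpow]; ring

lemma half_log_sq_add_sub_log {y δ : ℝ} (hy : 0 < y) :
    Real.log (y ^ 2 + δ ^ 2) / 2 - Real.log y = Real.log (1 + δ ^ 2 / y ^ 2) / 2 := by
  have h1 : y ^ 2 + δ ^ 2 = y ^ 2 * (1 + δ ^ 2 / y ^ 2) := by field_simp
  rw [h1, Real.log_mul (by positivity) (by positivity), Real.log_pow]
  push_cast
  ring

/-- Regularising the logarithm at scale `δ` costs at most a negative power. -/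
lemma half_log_sq_add_sub_log_le {y δ q : ℝ} (hy : 0 < y) (hδ : 0 < δ) (hq : 0 < q) (hq2 : q ≤ 2) :
    Real.log (y ^ 2 + δ ^ 2) / 2 - Real.log y ≤ δ ^ q / q * y ^ (-q) := by
  rw [half_log_sq_add_sub_log hy]
  have h1 := log_one_add_le_rpow_div (z := δ ^ 2 / y ^ 2) (p := q / 2) (by positivity)
    (by positivity) (by linarith)
  have h2 : (δ ^ 2 / y ^ 2) ^ (q / 2) = δ ^ q * y ^ (-q) := by
    rw [← div_pow, ← Real.rpow_natCast, ← Real.rpow_mul (by positivity), Real.div_rpow hδ.le hy.le,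
      Real.rpow_neg hy.le, div_eq_mul_inv]
    norm_num
    congr 2 <;> congr 1 <;> ring
  rw [h2] at h1
  calc _ ≤ δ ^ q * y ^ (-q) / (q / 2) / 2 := by gcongr
    _ = _ := by field_simp

lemma half_log_sq_add_sub_log_nonneg {y δ : ℝ} (hy : 0 < y) :
    0 ≤ Real.log (y ^ 2 + δ ^ 2) / 2 - Real.log y := by
  rw [half_log_sq_add_sub_log hy]
  have : 0 ≤ Real.log (1 + δ ^ 2 / y ^ 2) :=
    Real.log_nonneg (by linarith [show 0 ≤ δ ^ 2 / y ^ 2 by positivity])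
  linarith

/-- The cost of regularising the logarithm at scale `δ` is controlled by the increment of the
regularised logarithm from scale `δ` to scale `2 δ`, up to a negligible negative power. -/
lemma half_log_sq_add_sub_log_le_increment {y δ q : ℝ} (hy : 0 < y) (hδ : 0 < δ) (hδ2 : δ ≤ 1 / 2)
    (hq : 0 < q) :
    Real.log (y ^ 2 + δ ^ 2) / 2 - Real.log y ≤
      (4 + 8 / q) * Real.log (1 / δ) *
        (Real.log (y ^ 2 + (2 * δ) ^ 2) / 2 - Real.log (y ^ 2 + δ ^ 2) / 2) +
      (4 + 8 / q) * δ * y ^ (-q) := by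
  have hlog : 1 / 2 ≤ Real.log (1 / δ) := by
    have h1 : Real.log 2 ≤ Real.log (1 / δ) :=
      Real.log_le_log (by norm_num) (by rw [le_div_iff₀ hδ]; linarith)
    linarith [Real.log_two_gt_d9]
  set G := Real.log (y ^ 2 + (2 * δ) ^ 2) / 2 - Real.log (y ^ 2 + δ ^ 2) / 2 with hG
  have hGge : 3 * δ ^ 2 / (2 * (y ^ 2 + 4 * δ ^ 2)) ≤ G := by
    have h1 := Real.one_sub_inv_le_log_of_pos
      (x := (y ^ 2 + (2 * δ) ^ 2) / (y ^ 2 + δ ^ 2)) (by positivity)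
    rw [Real.log_div (by positivity) (by positivity)] at h1
    have h2 : 1 - ((y ^ 2 + (2 * δ) ^ 2) / (y ^ 2 + δ ^ 2))⁻¹ = 3 * δ ^ 2 / (y ^ 2 + 4 * δ ^ 2) := by
      have : y ^ 2 + (2 * δ) ^ 2 = y ^ 2 + 4 * δ ^ 2 := by ring
      rw [this]
      field_simp
      ring
    rw [h2] at h1
    calc 3 * δ ^ 2 / (2 * (y ^ 2 + 4 * δ ^ 2)) = 3 * δ ^ 2 / (y ^ 2 + 4 * δ ^ 2) / 2 := by
          field_simp
      _ ≤ G := by rw [hG]; linarith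
  have hG0 : 0 ≤ G := le_trans (by positivity) hGge
  have hy' : 0 < y ^ (-q) := Real.rpow_pos_of_pos hy _
  have hq8 : 0 < 8 / q := by positivity
  have hlast : 0 ≤ (4 + 8 / q) * δ * y ^ (-q) := by positivity
  rw [half_log_sq_add_sub_log hy]
  rcases le_or_gt δ y with h1 | h1
  · have hyy : δ ^ 2 ≤ y ^ 2 := by gcongr
    have h2 : Real.log (1 + δ ^ 2 / y ^ 2) ≤ δ ^ 2 / y ^ 2 := by
      linarith [Real.log_le_sub_one_of_pos (x := 1 + δ ^ 2 / y ^ 2) (by positivity)]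
    have h3 : δ ^ 2 / y ^ 2 / 2 ≤ 2 * (3 * δ ^ 2 / (2 * (y ^ 2 + 4 * δ ^ 2))) := by
      rw [div_div, ← mul_div_assoc, div_le_div_iff₀ (by positivity) (by positivity)]
      nlinarith [mul_le_mul_of_nonneg_left hyy (sq_nonneg δ)]
    have h4 : 2 * G ≤ (4 + 8 / q) * Real.log (1 / δ) * G := by
      gcongr
      nlinarith
    linarith
  have hyy : y ^ 2 < δ ^ 2 := by gcongr
  have h2 : Real.log (1 + δ ^ 2 / y ^ 2) ≤ 2 * Real.log (1 / y) := by
    have : 2 * Real.log (1 / y) = Real.log ((1 / y) ^ 2) := by rw [Real.log_pow]; norm_num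
    rw [this]
    refine Real.log_le_log (by positivity) ?_
    rw [div_pow, one_pow, ← sub_nonneg]
    have : 1 / y ^ 2 - (1 + δ ^ 2 / y ^ 2) = (1 - y ^ 2 - δ ^ 2) / y ^ 2 := by
      field_simp
      ring
    rw [this]
    have : δ ^ 2 ≤ (1 / 2) ^ 2 := by gcongr
    exact div_nonneg (by nlinarith) (by positivity)
  rcases le_or_gt (δ ^ (2 / q)) y with h3 | h3
  · have h4 : Real.log (1 / y) ≤ 2 / q * Real.log (1 / δ) := by
      rw [one_div, one_div, Real.log_inv, Real.log_inv]
      have := Real.log_le_log (by positivity) h3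
      rw [Real.log_rpow hδ] at this
      linarith
    have h5 : 1 ≤ 4 * G := by
      have : 1 / 4 ≤ 3 * δ ^ 2 / (2 * (y ^ 2 + 4 * δ ^ 2)) := by
        rw [div_le_div_iff₀ (by norm_num) (by positivity)]
        nlinarith
      linarith
    have h6 : 0 ≤ 2 / q * Real.log (1 / δ) := by positivity
    calc Real.log (1 + δ ^ 2 / y ^ 2) / 2 ≤ 2 / q * Real.log (1 / δ) := by linarith
      _ ≤ 2 / q * Real.log (1 / δ) * (4 * G) := le_mul_of_one_le_right h6 h5
      _ = 8 / q * Real.log (1 / δ) * G := by ring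
      _ ≤ (4 + 8 / q) * Real.log (1 / δ) * G := by gcongr; linarith
      _ ≤ _ := by linarith
  · have h4 : Real.log (1 / y) ≤ (1 / y) ^ (q / 2) / (q / 2) :=
      Real.log_le_rpow_div (by positivity) (by positivity)
    have h5 : (1 / y) ^ (q / 2) = y ^ (q / 2) * y ^ (-q) := by
      rw [one_div, Real.inv_rpow hy.le, ← Real.rpow_neg hy.le, ← Real.rpow_add hy]
      congr 1
      ring
    have h6 : y ^ (q / 2) ≤ δ := by
      calc y ^ (q / 2) ≤ (δ ^ (2 / q)) ^ (q / 2) := by gcongr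
        _ = δ := by
          rw [← Real.rpow_mul hδ.le, div_mul_div_comm, mul_comm, div_self (by positivity),
            Real.rpow_one]
    have h7 : (1 / y) ^ (q / 2) / (q / 2) ≤ (4 + 8 / q) * δ * y ^ (-q) := by
      rw [h5]
      calc y ^ (q / 2) * y ^ (-q) / (q / 2) ≤ δ * y ^ (-q) / (q / 2) := by gcongr
        _ = (2 / q) * δ * y ^ (-q) := by field_simp
        _ ≤ (4 + 8 / q) * δ * y ^ (-q) := by
          gcongr
          have : 2 / q ≤ 8 / q := by gcongr; norm_num
          linarith
    have h8 : 0 ≤ (4 + 8 / q) * Real.log (1 / δ) * G := by positivity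
    linarith

/-- Truncation error of the logarithmic series away from its singularity. -/
lemma abs_log_taylor_le {w κ : ℝ} (hκ : 0 < κ) (hw : 0 ≤ w) (hwκ : w ≤ 1 - κ) (N : ℕ) :
    |(∑ i ∈ Finset.range N, w ^ (i + 1) / ((i : ℝ) + 1)) + Real.log (1 - w)| ≤
      6 / (κ ^ 4 * ((N : ℝ) + 1) ^ 3) := by
  have h1 := Real.abs_log_sub_add_sum_range_le (x := w) (by rw [abs_of_nonneg hw]; linarith) N
  rw [abs_of_nonneg hw] at h1
  refine h1.trans ?_
  set x := κ * ((N : ℝ) + 1) with hx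
  have hx0 : 0 < x := by positivity
  have h2 : w ^ (N + 1) ≤ Real.exp (-x) := by
    calc w ^ (N + 1) ≤ (Real.exp (-κ)) ^ (N + 1) := by
          gcongr
          linarith [Real.add_one_le_exp (-κ)]
      _ = Real.exp (-x) := by
          rw [← Real.exp_nat_mul]
          congr 1
          push_cast
          rw [hx]
          ring
  have h3 : Real.exp (-x) ≤ 6 / x ^ 3 := by
    have := Real.pow_div_factorial_le_exp x hx0.le 3
    rw [Real.exp_neg, inv_le_comm₀ (Real.exp_pos x) (by positivity), inv_div]
    simpa [Nat.factorial] using this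
  calc w ^ (N + 1) / (1 - w) ≤ (6 / x ^ 3) / κ := by
        gcongr
        · exact h2.trans h3
        · linarith
    _ = _ := by rw [hx]; field_simp

/-- Trigonometric polynomials on the torus with frequencies of maximum norm at most `D`. -/
noncomputable def trigSpan (n : ℕ) (D : ℝ) : Submodule ℂ C(UnitAddTorus (Fin n), ℂ) :=
  Submodule.span ℂ (mFourier '' {m : Fin n → ℤ | ‖m‖ ≤ D})

lemma mFourier_mem_trigSpan {n : ℕ} {D : ℝ} {m : Fin n → ℤ} (hm : ‖m‖ ≤ D) :
    mFourier m ∈ trigSpan n D :=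
  Submodule.subset_span ⟨m, hm, rfl⟩

lemma trigSpan_mono {n : ℕ} {D D' : ℝ} (h : D ≤ D') : trigSpan n D ≤ trigSpan n D' :=
  Submodule.span_mono (image_mono fun _ hm => le_trans hm h)

lemma one_mem_trigSpan {n : ℕ} {D : ℝ} (hD : 0 ≤ D) : (1 : C(UnitAddTorus (Fin n), ℂ)) ∈ trigSpan n D := by
  rw [← mFourier_zero]
  exact mFourier_mem_trigSpan (by simpa using hD)

lemma mul_mem_trigSpan {n : ℕ} {D D' : ℝ} {f g : C(UnitAddTorus (Fin n), ℂ)}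
    (hf : f ∈ trigSpan n D) (hg : g ∈ trigSpan n D') : f * g ∈ trigSpan n (D + D') := by
  have h := Submodule.mul_mem_mul hf hg
  rw [trigSpan, trigSpan, Submodule.span_mul_span] at h
  refine Submodule.span_mono ?_ h
  rintro _ ⟨_, ⟨m, hm, rfl⟩, _, ⟨m', hm', rfl⟩, rfl⟩
  refine ⟨m + m', (norm_add_le m m').trans (add_le_add hm hm'), ?_⟩
  ext x
  exact mFourier_add

lemma pow_mem_trigSpan {n : ℕ} {D : ℝ} {f : C(UnitAddTorus (Fin n), ℂ)}
    (hf : f ∈ trigSpan n D) (j : ℕ) : f ^ j ∈ trigSpan n (j * D) := by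
  induction j with
  | zero => simpa using one_mem_trigSpan le_rfl
  | succ j ih =>
    rw [pow_succ]
    have := mul_mem_trigSpan ih hf
    rwa [show (j : ℝ) * D + D = ((j + 1 : ℕ) : ℝ) * D by push_cast; ring] at this

lemma star_mem_trigSpan {n : ℕ} {D : ℝ} {f : C(UnitAddTorus (Fin n), ℂ)}
    (hf : f ∈ trigSpan n D) : star f ∈ trigSpan n D := by
  refine Submodule.span_induction (p := fun f _ => star f ∈ trigSpan n D) ?_ ?_ ?_ ?_ hf
  · rintro _ ⟨m, hm, rfl⟩
    have : star (mFourier m) = mFourier (-m) := by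
      ext x
      rw [mFourier_neg]
      rfl
    rw [this]
    exact mFourier_mem_trigSpan (by rwa [norm_neg])
  · simp
  · intro f g _ _ hf hg
    rw [star_add]
    exact add_mem hf hg
  · intro c f _ hf
    rw [star_smul]
    exact Submodule.smul_mem _ _ hf

lemma integral_mFourier_of_ne_zero {n : ℕ} {m : Fin n → ℤ} (hm : m ≠ 0) :
    ∫ x, mFourier m x = 0 := by
  obtain ⟨i, hi⟩ := Function.ne_iff.1 hm
  have hi' : (m i : ℝ) ≠ 0 := by exact_mod_cast hi
  set h : UnitAddTorus (Fin n) := torusMk (Pi.single i (1 / (2 * m i)))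
  have hh : mFourier m h = -1 := by
    rw [mFourier_torusMk]
    have : ∑ j, (m j : ℝ) * (Pi.single i (1 / (2 * (m i : ℝ))) : Fin n → ℝ) j = 1 / 2 := by
      rw [Finset.sum_eq_single i]
      · rw [Pi.single_eq_same]
        field_simp
      · intro j _ hj
        rw [Pi.single_eq_of_ne hj, mul_zero]
      · simp
    rw [this, ← Complex.exp_pi_mul_I]
    congr 1
    push_cast
    ring
  have h1 : ∫ x, mFourier m (x + h) = ∫ x, mFourier m x :=
    integral_add_right_eq_self (fun x => mFourier m x) h
  simp only [mFourier_apply_add, hh, mul_neg, mul_one, integral_neg] at h1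
  have h2 : (2 : ℂ) * ∫ x, mFourier m x = 0 := by linear_combination -h1
  simpa using h2

/-- The one-parameter subgroup `t ↦ (a₁ t, …, aₙ t)` of the torus. -/
noncomputable def torusLine {n : ℕ} (a : Fin n → ℤ) : C(UnitAddTorus (Fin 1), UnitAddTorus (Fin n)) where
  toFun t i := a i • t 0
  continuous_toFun := by fun_prop

lemma mFourier_torusLine {n : ℕ} (m a : Fin n → ℤ) (t : UnitAddTorus (Fin 1)) :
    mFourier m (torusLine a t) = mFourier (fun _ : Fin 1 => m ⬝ᵥ a) t := by
  simp only [mFourier, torusLine, ContinuousMap.coe_mk, fourier_apply, smul_smul, dotProduct,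
    Fin.prod_univ_one, Finset.sum_smul]
  have h : ∀ s : Finset (Fin n), AddCircle.toCircle (∑ i ∈ s, (m i * a i) • t 0) =
      ∏ i ∈ s, AddCircle.toCircle ((m i * a i) • t 0) := by
    intro s
    classical
    induction s using Finset.induction_on with
    | empty => simp
    | insert i s hi ih => rw [Finset.sum_insert hi, Finset.prod_insert hi, AddCircle.toCircle_add, ih]
  rw [h]
  exact (map_prod Circle.coeHom _ _).symm

/-- Trigonometric polynomials of small degree have the same mean on the torus and along a line
satisfying no small relation. -/
lemma integral_torusLine {n : ℕ} {a : Fin n → ℤ} {T D : ℝ}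
    (ha : ∀ ω : Fin n → ℤ, ω ≠ 0 → ω ⬝ᵥ a = 0 → T ≤ ‖ω‖) (hDT : D < T)
    {f : C(UnitAddTorus (Fin n), ℂ)} (hf : f ∈ trigSpan n D) :
    ∫ t, f (torusLine a t) = ∫ x, f x := by
  have hint : ∀ {r : ℕ} (g : C(UnitAddTorus (Fin r), ℂ)), Integrable (fun x => g x) := fun g =>
    g.continuous.integrable_of_hasCompactSupport (HasCompactSupport.of_compactSpace _)
  refine Submodule.span_induction
    (p := fun f _ => ∫ t, f (torusLine a t) = ∫ x, f x) ?_ ?_ ?_ ?_ hf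
  · rintro _ ⟨m, hm, rfl⟩
    simp only [mFourier_torusLine]
    by_cases h0 : m = 0
    · subst h0
      have : (fun _ : Fin 1 => (0 : Fin n → ℤ) ⬝ᵥ a) = 0 := by ext; simp
      rw [this]
      simp [mFourier_zero]
    · have hne : (fun _ : Fin 1 => m ⬝ᵥ a) ≠ 0 := fun h =>
        absurd (ha m h0 (congrFun h 0)) (not_le.2 (lt_of_le_of_lt hm hDT))
      rw [integral_mFourier_of_ne_zero h0, integral_mFourier_of_ne_zero hne]
  · simp
  · intro f g _ _ hf hg
    simp only [ContinuousMap.add_apply]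
    have h1 := integral_add (hint (f.comp (torusLine a))) (hint (g.comp (torusLine a)))
    simp only [ContinuousMap.comp_apply] at h1
    rw [h1, integral_add (hint f) (hint g), hf, hg]
  · intro c f _ hf
    simp only [ContinuousMap.smul_apply]
    rw [integral_smul, integral_smul, hf]

/-- The regularised logarithm of a trigonometric polynomial has almost the same mean on the torus
and along a line satisfying no small relation. -/
lemma abs_integral_log_reg_sub_le {n : ℕ} {a : Fin n → ℤ} {T d B δ : ℝ}
    (ha : ∀ ω : Fin n → ℤ, ω ≠ 0 → ω ⬝ᵥ a = 0 → T ≤ ‖ω‖) (hd : 0 ≤ d) (hB : 0 < B) (hδ : 0 < δ)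
    {N : ℕ} (hN : N * (2 * d) < T) {p : C(UnitAddTorus (Fin n), ℂ)} (hp : p ∈ trigSpan n d)
    (hpB : ∀ x, ‖p x‖ ^ 2 ≤ B) :
    |(∫ t, Real.log (‖p (torusLine a t)‖ ^ 2 + δ ^ 2) / 2) -
        ∫ x, Real.log (‖p x‖ ^ 2 + δ ^ 2) / 2| ≤
      6 / ((δ ^ 2 / (B + δ ^ 2)) ^ 4 * ((N : ℝ) + 1) ^ 3) := by
  set E := B + δ ^ 2 with hE
  have hE0 : 0 < E := by positivity
  set err := 6 / ((δ ^ 2 / E) ^ 4 * ((N : ℝ) + 1) ^ 3) with herr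
  let w : C(UnitAddTorus (Fin n), ℂ) := ((1 / E : ℝ) : ℂ) • ((B : ℂ) • 1 - p * star p)
  let V : C(UnitAddTorus (Fin n), ℂ) := ∑ i ∈ Finset.range N, ((1 / ((i : ℝ) + 1) : ℝ) : ℂ) • w ^ (i + 1)
  have hw : w ∈ trigSpan n (2 * d) := by
    refine Submodule.smul_mem _ _ (sub_mem (Submodule.smul_mem _ _ (one_mem_trigSpan (by positivity))) ?_)
    rw [two_mul]
    exact mul_mem_trigSpan hp (star_mem_trigSpan hp)
  have hV : V ∈ trigSpan n (N * (2 * d)) := by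
    refine Submodule.sum_mem _ fun i hi => Submodule.smul_mem _ _ ?_
    refine trigSpan_mono ?_ (pow_mem_trigSpan hw (i + 1))
    gcongr
    exact_mod_cast Finset.mem_range.1 hi
  let wr : UnitAddTorus (Fin n) → ℝ := fun x => (B - ‖p x‖ ^ 2) / E
  have hwx : ∀ x, w x = (wr x : ℝ) := by
    intro x
    have : p x * star (p x) = ((‖p x‖ ^ 2 : ℝ) : ℂ) := by
      rw [← Complex.normSq_eq_norm_sq, ← Complex.mul_conj]
      rfl
    simp only [w, wr, ContinuousMap.smul_apply, ContinuousMap.sub_apply, ContinuousMap.mul_apply,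
      ContinuousMap.star_apply, ContinuousMap.one_apply, this, smul_eq_mul]
    push_cast
    ring
  have hVx : ∀ x, V x = ((∑ i ∈ Finset.range N, wr x ^ (i + 1) / ((i : ℝ) + 1) : ℝ) : ℂ) := by
    intro x
    simp only [V, ContinuousMap.sum_apply, ContinuousMap.smul_apply, ContinuousMap.pow_apply, hwx,
      smul_eq_mul]
    push_cast
    exact Finset.sum_congr rfl fun i _ => by ring
  have hpt : ∀ x, |Real.log (‖p x‖ ^ 2 + δ ^ 2) / 2 - (Real.log E / 2 - (V x).re / 2)| ≤ err / 2 := by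
    intro x
    have h1 : 1 - wr x = (‖p x‖ ^ 2 + δ ^ 2) / E := by
      simp only [wr]
      field_simp
      rw [hE]
      ring
    have h2 := abs_log_taylor_le (w := wr x) (κ := δ ^ 2 / E) (by positivity)
      (div_nonneg (sub_nonneg.2 (hpB x)) hE0.le) (by
        have : δ ^ 2 / E ≤ 1 - wr x := by
          rw [h1]
          gcongr
          linarith [sq_nonneg ‖p x‖]
        linarith) N
    rw [h1, Real.log_div (by positivity) hE0.ne'] at h2
    rw [hVx, Complex.ofReal_re]
    rw [abs_le] at h2 ⊢
    constructor <;> linarith [h2.1, h2.2]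
  have hreg : Continuous fun x => Real.log (‖p x‖ ^ 2 + δ ^ 2) / 2 := by
    refine Continuous.div_const (Continuous.log (by fun_prop) fun x => ?_) 2
    positivity
  have hVr : Continuous fun x => Real.log E / 2 - (V x).re / 2 := by fun_prop
  have hcl : ∀ (r : ℕ) (φ : C(UnitAddTorus (Fin r), UnitAddTorus (Fin n))),
      |(∫ t, Real.log (‖p (φ t)‖ ^ 2 + δ ^ 2) / 2) - ((Real.log E / 2) - (∫ t, V (φ t)).re / 2)| ≤
        err / 2 := by
    intro r φ
    have hint : ∀ {F : UnitAddTorus (Fin n) → ℝ}, Continuous F → Integrable (fun t => F (φ t)) := fun hF =>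
      (hF.comp φ.continuous).integrable_of_hasCompactSupport (HasCompactSupport.of_compactSpace _)
    have hV1 : (∫ t, V (φ t)).re = ∫ t, (V (φ t)).re := by
      have : Integrable (fun t => V (φ t)) :=
        (V.continuous.comp φ.continuous).integrable_of_hasCompactSupport
          (HasCompactSupport.of_compactSpace _)
      exact (integral_re this).symm
    have hV2 : ∫ t, (Real.log E / 2 - (V (φ t)).re / 2) = Real.log E / 2 - (∫ t, V (φ t)).re / 2 := by
      rw [hV1, integral_sub (integrable_const _)
        (hint (F := fun x => (V x).re / 2) (by fun_prop))]
      simp only [integral_const, probReal_univ, one_smul]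
      rw [integral_div]
    rw [← hV2, ← integral_sub (hint hreg) (hint hVr)]
    have := norm_integral_le_of_norm_le_const (μ := (volume : Measure (UnitAddTorus (Fin r))))
      (f := fun t => Real.log (‖p (φ t)‖ ^ 2 + δ ^ 2) / 2 - (Real.log E / 2 - (V (φ t)).re / 2))
      (C := err / 2) (Filter.Eventually.of_forall fun t => hpt (φ t))
    simpa using this
  have h1 := hcl 1 (torusLine a)
  have h2 := hcl n (ContinuousMap.id _)
  simp only [ContinuousMap.id_apply] at h2
  rw [integral_torusLine ha hN hV] at h1
  rw [abs_le] at h1 h2 ⊢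
  constructor <;> linarith [h1.1, h1.2, h2.1, h2.2]

/-- Integrability of a logarithm and cost of its regularisation, from a negative moment. -/
lemma integral_log_reg_bounds {Ω : Type*} [MeasurableSpace Ω] (μ : Measure Ω)
    [IsProbabilityMeasure μ] {f : Ω → ℝ} (hf : Measurable f) (hf0 : ∀ x, 0 ≤ f x) {Y : ℝ}
    (hY : ∀ x, f x ≤ Y) {q D : ℝ} (hq : 0 < q) (hq2 : q ≤ 2) (hpos : ∀ᵐ x ∂μ, 0 < f x)
    (hint : Integrable (fun x => f x ^ (-q)) μ) (hD : ∫ x, f x ^ (-q) ∂μ ≤ D) :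
    Integrable (fun x => Real.log (f x)) μ ∧ ∀ δ > 0,
      (0 ≤ (∫ x, Real.log (f x ^ 2 + δ ^ 2) / 2 ∂μ) - ∫ x, Real.log (f x) ∂μ) ∧
      ((∫ x, Real.log (f x ^ 2 + δ ^ 2) / 2 ∂μ) - ∫ x, Real.log (f x) ∂μ ≤ δ ^ q / q * D) ∧
      (δ ≤ 1 / 2 → (∫ x, Real.log (f x ^ 2 + δ ^ 2) / 2 ∂μ) - ∫ x, Real.log (f x) ∂μ ≤
        (4 + 8 / q) * Real.log (1 / δ) * ((∫ x, Real.log (f x ^ 2 + (2 * δ) ^ 2) / 2 ∂μ) -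
          ∫ x, Real.log (f x ^ 2 + δ ^ 2) / 2 ∂μ) + (4 + 8 / q) * δ * D) := by
  have hreg : ∀ δ > 0, Integrable (fun x => Real.log (f x ^ 2 + δ ^ 2) / 2) μ := by
    intro δ hδ
    refine Integrable.of_mem_Icc (Real.log (δ ^ 2) / 2) (Real.log (Y ^ 2 + δ ^ 2) / 2) (by fun_prop)
      (Filter.Eventually.of_forall fun x => ⟨?_, ?_⟩)
    · gcongr
      linarith [sq_nonneg (f x)]
    · have := hf0 x
      have h1 := hY x
      gcongr
  have hlog : Integrable (fun x => Real.log (f x)) μ := by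
    have h1 : Integrable (fun x => Real.log (f x ^ 2 + 1 ^ 2) / 2 - Real.log (f x)) μ := by
      refine (hint.const_mul (1 ^ q / q)).mono' (by fun_prop) ?_
      filter_upwards [hpos] with x hx
      rw [Real.norm_of_nonneg (half_log_sq_add_sub_log_nonneg hx)]
      exact half_log_sq_add_sub_log_le hx one_pos hq hq2
    refine ((hreg 1 one_pos).sub h1).congr (Filter.Eventually.of_forall fun x => ?_)
    simp
  refine ⟨hlog, fun δ hδ => ⟨?_, ?_, fun hδ2 => ?_⟩⟩
  · rw [← integral_sub (hreg δ hδ) hlog]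
    refine integral_nonneg_of_ae ?_
    filter_upwards [hpos] with x hx
    exact half_log_sq_add_sub_log_nonneg hx
  · rw [← integral_sub (hreg δ hδ) hlog]
    calc _ ≤ ∫ x, δ ^ q / q * f x ^ (-q) ∂μ := by
          refine integral_mono_ae ((hreg δ hδ).sub hlog) (hint.const_mul _) ?_
          filter_upwards [hpos] with x hx
          exact half_log_sq_add_sub_log_le hx hδ hq hq2
      _ = δ ^ q / q * ∫ x, f x ^ (-q) ∂μ := integral_const_mul _ _
      _ ≤ δ ^ q / q * D := by gcongr
  · have h2 := hreg (2 * δ) (by positivity)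
    rw [← integral_sub (hreg δ hδ) hlog, ← integral_sub h2 (hreg δ hδ)]
    calc _ ≤ ∫ x, ((4 + 8 / q) * Real.log (1 / δ) *
            (Real.log (f x ^ 2 + (2 * δ) ^ 2) / 2 - Real.log (f x ^ 2 + δ ^ 2) / 2) +
            (4 + 8 / q) * δ * f x ^ (-q)) ∂μ := by
          refine integral_mono_ae ((hreg δ hδ).sub hlog)
            (((h2.sub (hreg δ hδ)).const_mul _).add (hint.const_mul _)) ?_
          filter_upwards [hpos] with x hx
          exact half_log_sq_add_sub_log_le_increment hx hδ hδ2 hq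
      _ = (4 + 8 / q) * Real.log (1 / δ) *
            (∫ x, (Real.log (f x ^ 2 + (2 * δ) ^ 2) / 2 - Real.log (f x ^ 2 + δ ^ 2) / 2) ∂μ) +
            (4 + 8 / q) * δ * ∫ x, f x ^ (-q) ∂μ := by
          rw [← integral_const_mul, ← integral_const_mul]
          exact integral_add ((h2.sub (hreg δ hδ)).const_mul _) (hint.const_mul _)
      _ ≤ _ := by gcongr

/-- The trigonometric polynomial with coefficients `c` on the finite set `s`. -/
noncomputable def trigPoly {n : ℕ} (s : Finset (Fin n → ℤ)) (c : (Fin n → ℤ) → ℂ) :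
    C(UnitAddTorus (Fin n), ℂ) := ∑ m ∈ s, c m • mFourier m

lemma trigPoly_apply {n : ℕ} (s : Finset (Fin n → ℤ)) (c : (Fin n → ℤ) → ℂ)
    (x : UnitAddTorus (Fin n)) : trigPoly s c x = ∑ m ∈ s, c m * mFourier m x := by
  simp [trigPoly, ContinuousMap.sum_apply]

lemma dotProduct_injOn_of_forall_le_norm {n : ℕ} {s : Finset (Fin n → ℤ)} {d T : ℝ}
    (hd : ∀ m ∈ s, ‖m‖ ≤ d) (hT : 2 * d < T) {a : Fin n → ℤ}
    (ha : ∀ ω : Fin n → ℤ, ω ≠ 0 → ω ⬝ᵥ a = 0 → T ≤ ‖ω‖) :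
    InjOn (fun m : Fin n → ℤ => m ⬝ᵥ a) s := by
  intro m hm m' hm' h
  by_contra hne
  have h1 := ha (m - m') (sub_ne_zero.2 hne) (by rw [sub_dotProduct]; exact sub_eq_zero.2 h)
  linarith [norm_sub_le m m', hd m hm, hd m' hm']

/-- Negative moments of a trigonometric polynomial along lines, uniform in the line. -/
lemma exists_line_moment_le {n : ℕ} (s : Finset (Fin n → ℤ)) (c : (Fin n → ℤ) → ℂ)
    (hc : ∀ m ∈ s, c m ≠ 0) (hs : s.Nonempty) :
    ∃ q : ℝ, 0 < q ∧ q ≤ 1 ∧ ∃ D : ℝ, 0 ≤ D ∧ ∀ a : Fin n → ℤ,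
      InjOn (fun m : Fin n → ℤ => m ⬝ᵥ a) s →
      (∀ᵐ t : UnitAddTorus (Fin 1), 0 < ‖trigPoly s c (torusLine a t)‖) ∧
      Integrable (fun t => ‖trigPoly s c (torusLine a t)‖ ^ (-q)) ∧
      ∫ t, ‖trigPoly s c (torusLine a t)‖ ^ (-q) ≤ D := by
  obtain ⟨K, hK, hsep⟩ := exists_character_separation
  obtain ⟨σ, hσ, hσ1, C, hC, hA⟩ := exists_character_sublevel_le (ι := Fin n → ℤ)
    (volume : Measure (UnitAddTorus (Fin 1))) hK (s.card - 1)
  obtain ⟨m₀, hm₀, hmin⟩ := s.exists_min_image (fun m => ‖c m‖) hs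
  set γ := ‖c m₀‖ with hγ
  have hγ0 : 0 < γ := norm_pos_iff.2 (hc m₀ hm₀)
  obtain ⟨D, hD, hmom⟩ := exists_integral_rpow_neg_le (volume : Measure (UnitAddTorus (Fin 1)))
    (C := C * γ⁻¹ ^ σ) (s := σ) (q := σ / 2) (by positivity) (by positivity) (by linarith)
  refine ⟨σ / 2, by positivity, by linarith, D, hD, fun a ha => ?_⟩
  refine hmom _ ((map_continuous (trigPoly s c)).comp (map_continuous (torusLine a))).norm.measurable
    (fun t => norm_nonneg _) fun δ hδ => ?_
  have h1 := hA (fun m t => mFourier (fun _ : Fin 1 => m ⬝ᵥ a) t) s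
    (by have := hs.card_pos; omega)
    (fun m _ => (map_continuous _).measurable) (fun m _ x y => mFourier_apply_add _ x y)
    (fun m _ x => norm_mFourier_apply _ x)
    (fun m hm m' hm' hne η hη => hsep _ _ (fun h => hne (ha hm hm' (congrFun h 0))) η hη)
    (fun m => c m / γ) (fun m hm => by
      rw [norm_div, Complex.norm_real, Real.norm_of_nonneg hγ0.le, one_le_div hγ0]
      exact hmin m hm) (δ / γ) (by positivity)
  have h2 : {t : UnitAddTorus (Fin 1) | ‖trigPoly s c (torusLine a t)‖ < δ} =
      {t | ‖∑ m ∈ s, c m / γ * mFourier (fun _ : Fin 1 => m ⬝ᵥ a) t‖ < δ / γ} := by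
    ext t
    have : ∑ m ∈ s, c m / γ * mFourier (fun _ : Fin 1 => m ⬝ᵥ a) t =
        trigPoly s c (torusLine a t) / γ := by
      rw [trigPoly_apply, Finset.sum_div]
      exact Finset.sum_congr rfl fun m _ => by rw [mFourier_torusLine]; ring
    simp only [mem_ofPred_eq]
    rw [this, norm_div, Complex.norm_real, Real.norm_of_nonneg hγ0.le, div_lt_div_iff_of_pos_right hγ0]
  rw [h2]
  refine h1.trans (ENNReal.ofReal_le_ofReal (le_of_eq ?_))
  rw [div_eq_mul_inv, Real.mul_rpow hδ.le (by positivity)]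
  ring

/-- The arithmetic comparing two logarithmic means through their regularisations. -/
lemma abs_sub_le_of_regularized_bounds {δ q D E A D' mH ma rH rH2 ra ra2 : ℝ} (hδ0 : 0 < δ)
    (hδ2 : δ ≤ 1 / 2) (hq0 : 0 < q) (hq1 : q ≤ 1) (hD0 : 0 ≤ D) (hE0 : 0 ≤ E) (hA0 : 0 ≤ A)
    (hD'0 : 0 ≤ D') (e1 : -(E * δ) ≤ ra - rH ∧ ra - rH ≤ E * δ)
    (e2 : -(E * δ) ≤ ra2 - rH2 ∧ ra2 - rH2 ≤ E * δ) (a1 : 0 ≤ ra - ma)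
    (a3 : ra - ma ≤ A * Real.log (1 / δ) * (ra2 - ra) + A * δ * D') (b1 : 0 ≤ rH - mH)
    (b2 : rH - mH ≤ δ ^ q / q * D) (b4 : rH2 - mH ≤ (2 * δ) ^ q / q * D) :
    |ma - mH| ≤ (2 * (D / q + E) + A * (2 * D / q + 2 * E) + 2 * A * D') *
      (Real.log (1 / δ) * δ ^ q) := by
  have hlog : 1 / 2 ≤ Real.log (1 / δ) := by
    have h1 : Real.log 2 ≤ Real.log (1 / δ) :=
      Real.log_le_log (by norm_num) (by rw [le_div_iff₀ hδ0]; linarith)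
    linarith [Real.log_two_gt_d9]
  set ℓ := Real.log (1 / δ) with hℓ
  have hδq : δ ≤ δ ^ q := by
    calc δ = δ ^ (1 : ℝ) := (Real.rpow_one δ).symm
      _ ≤ δ ^ q := Real.rpow_le_rpow_of_exponent_ge hδ0 (by linarith) hq1
  have h2q : (2 * δ) ^ q ≤ 2 * δ ^ q := by
    rw [Real.mul_rpow (by norm_num) hδ0.le]
    gcongr
    calc (2 : ℝ) ^ q ≤ 2 ^ (1 : ℝ) := Real.rpow_le_rpow_of_exponent_le (by norm_num) hq1
      _ = 2 := Real.rpow_one 2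
  have hEq : E * δ ≤ E * δ ^ q := by gcongr
  have hDq : 0 ≤ D / q := by positivity
  have hδq0 : 0 < δ ^ q := by positivity
  have u1 : rH - mH ≤ D / q * δ ^ q := b2.trans (le_of_eq (by ring))
  have u2 : rH2 - mH ≤ 2 * D / q * δ ^ q := by
    refine b4.trans ?_
    calc (2 * δ) ^ q / q * D ≤ 2 * δ ^ q / q * D := by gcongr
      _ = _ := by ring
  have up : ma - mH ≤ (D / q + E) * δ ^ q := by linarith [e1.2]
  have inc : ra2 - ra ≤ (2 * D / q + 2 * E) * δ ^ q := by linarith [e1.1, e2.2]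
  have low : mH - ma ≤ E * δ ^ q + A * ℓ * ((2 * D / q + 2 * E) * δ ^ q) + A * D' * δ ^ q := by
    have h1 : A * ℓ * (ra2 - ra) ≤ A * ℓ * ((2 * D / q + 2 * E) * δ ^ q) := by gcongr
    have h2 : A * δ * D' ≤ A * D' * δ ^ q := by
      calc A * δ * D' ≤ A * δ ^ q * D' := by gcongr
        _ = _ := by ring
    linarith [e1.1]
  have h2l : δ ^ q ≤ 2 * (ℓ * δ ^ q) := by nlinarith
  have k1 : (D / q + E) * δ ^ q ≤ 2 * (D / q + E) * (ℓ * δ ^ q) := by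
    calc (D / q + E) * δ ^ q ≤ (D / q + E) * (2 * (ℓ * δ ^ q)) := by gcongr
      _ = _ := by ring
  have k2 : A * D' * δ ^ q ≤ 2 * A * D' * (ℓ * δ ^ q) := by
    calc A * D' * δ ^ q ≤ A * D' * (2 * (ℓ * δ ^ q)) := by gcongr
      _ = _ := by ring
  have hx0 : 0 ≤ ℓ * δ ^ q := by positivity
  have k3 : 0 ≤ A * (2 * D / q + 2 * E) * (ℓ * δ ^ q) := by positivity
  have k4 : 0 ≤ 2 * A * D' * (ℓ * δ ^ q) := by positivity
  have k5 : 0 ≤ D / q * δ ^ q := by positivity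
  have hMx : (2 * (D / q + E) + A * (2 * D / q + 2 * E) + 2 * A * D') * (ℓ * δ ^ q) = 2 * (D / q + E) * (ℓ * δ ^ q) +
      A * (2 * D / q + 2 * E) * (ℓ * δ ^ q) + 2 * A * D' * (ℓ * δ ^ q) := by ring
  rw [abs_le, hMx]
  constructor
  · have : A * ℓ * ((2 * D / q + 2 * E) * δ ^ q) = A * (2 * D / q + 2 * E) * (ℓ * δ ^ q) := by ring
    linarith
  · linarith

/-- The logarithmic mean of a trigonometric polynomial with `k` terms along a line satisfying no
relation of norm less than `T` is within `O(T ^ (-1 / (4 (k - 1))))` of its mean on the torus. -/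
theorem exists_abs_integral_log_torusLine_sub_le {n : ℕ} (s : Finset (Fin n → ℤ))
    (c : (Fin n → ℤ) → ℂ) (hc : ∀ m ∈ s, c m ≠ 0) (hs : 2 ≤ s.card) :
    Integrable (fun x => Real.log ‖trigPoly s c x‖) ∧
    ∃ C R : ℝ, 0 ≤ C ∧ 1 ≤ R ∧ ∀ T ≥ R, ∀ a : Fin n → ℤ,
      (∀ ω : Fin n → ℤ, ω ≠ 0 → ω ⬝ᵥ a = 0 → T ≤ ‖ω‖) →
      InjOn (fun m : Fin n → ℤ => m ⬝ᵥ a) s ∧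
      Integrable (fun t => Real.log ‖trigPoly s c (torusLine a t)‖) ∧
      |(∫ t, Real.log ‖trigPoly s c (torusLine a t)‖) - ∫ x, Real.log ‖trigPoly s c x‖| ≤
        C * T ^ (-(1 / (4 * ((s.card : ℝ) - 1)))) := by
  set p := trigPoly s c with hp
  have hk : 1 ≤ (s.card : ℝ) - 1 := by
    have : (2 : ℝ) ≤ s.card := by exact_mod_cast hs
    linarith
  set κ := (s.card : ℝ) - 1 with hκ
  have hκ0 : 0 < κ := by linarith
  set q := 7 / 8 * κ⁻¹ with hq
  have hκi : κ⁻¹ ≤ 1 := inv_le_one_of_one_le₀ hk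
  have hκi0 : 0 < κ⁻¹ := by positivity
  have hq0 : 0 < q := by positivity
  have hq1 : q ≤ 1 := by linarith
  -- bounds on the torus
  obtain ⟨CB, hCB, hB⟩ := exists_torus_sublevel_le s c hc hs
  obtain ⟨D, hD0, hD⟩ := exists_integral_rpow_neg_le (volume : Measure (UnitAddTorus (Fin n)))
    hCB hq0 (show q < κ⁻¹ by linarith)
  obtain ⟨hpos, hint, hDp⟩ := hD (fun x => ‖p x‖) (map_continuous p).norm.measurable
    (fun x => norm_nonneg _) (fun δ hδ => by
      simp only [hp, trigPoly_apply]
      exact hB δ hδ)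
  obtain ⟨hlogH, hH⟩ := integral_log_reg_bounds volume (map_continuous p).norm.measurable
    (fun x => norm_nonneg (p x)) (fun x => p.norm_coe_le_norm x) hq0 (by linarith) hpos hint hDp
  -- bounds along lines
  obtain ⟨q', hq'0, hq'1, D', hD'0, hline⟩ := exists_line_moment_le s c hc
    (Finset.card_pos.1 (by omega))
  set d : ℝ := ∑ m ∈ s, ‖m‖ with hd
  have hd0 : 0 ≤ d := by positivity
  have hmd : ∀ m ∈ s, ‖m‖ ≤ d := fun m hm =>
    Finset.single_le_sum (f := fun m : Fin n → ℤ => ‖m‖) (fun _ _ => norm_nonneg _) hm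
  have hpd : p ∈ trigSpan n d := Submodule.sum_mem _ fun m hm =>
    Submodule.smul_mem _ _ (mFourier_mem_trigSpan (hmd m hm))
  set B : ℝ := ‖p‖ ^ 2 + 1 with hBdef
  have hB0 : 0 < B := by positivity
  have hpB : ∀ x, ‖p x‖ ^ 2 ≤ B := fun x => by
    have : ‖p x‖ ^ 2 ≤ ‖p‖ ^ 2 := by gcongr; exact p.norm_coe_le_norm x
    linarith
  set E := 6 * (B + 1) ^ 4 * (2 * d + 1) ^ 3 with hE
  have hE0 : 0 ≤ E := by positivity
  set A := 4 + 8 / q' with hA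
  have hA4 : 4 ≤ A := by have : 0 < 8 / q' := by positivity
                         linarith
  set M := 2 * (D / q + E) + A * (2 * D / q + 2 * E) + 2 * A * D' with hM
  have hM0 : 0 ≤ M := by positivity
  refine ⟨hlogH, M * (8 * κ), max 8 (2 * d + 1), by positivity,
    le_trans (by norm_num) (le_max_left _ _), fun T hT a ha => ?_⟩
  have hT8 : 8 ≤ T := (le_max_left _ _).trans hT
  have hTd : 2 * d < T := by linarith [(le_max_right 8 (2 * d + 1)).trans hT]
  have hT0 : 0 < T := by linarith
  have hinj := dotProduct_injOn_of_forall_le_norm hmd hTd ha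
  obtain ⟨hposa, hinta, hDa⟩ := hline a hinj
  obtain ⟨hloga, hLa⟩ := integral_log_reg_bounds volume
    (f := fun t => ‖p (torusLine a t)‖)
    ((map_continuous p).comp (map_continuous (torusLine a))).norm.measurable
    (fun t => norm_nonneg _) (fun t => p.norm_coe_le_norm _) hq'0 (by linarith) hposa hinta hDa
  refine ⟨hinj, hloga, ?_⟩
  set δ : ℝ := T ^ (-(1 / 3) : ℝ) with hδ
  have hδ0 : 0 < δ := by positivity
  have hδ2 : δ ≤ 1 / 2 := by
    calc δ ≤ (8 : ℝ) ^ (-(1 / 3) : ℝ) :=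
          Real.rpow_le_rpow_of_nonpos (by norm_num) hT8 (by norm_num)
      _ = ((2 : ℝ) ^ (3 : ℝ)) ^ (-(1 / 3) : ℝ) := by norm_num
      _ = 1 / 2 := by rw [← Real.rpow_mul (by norm_num)]; norm_num [Real.rpow_neg_one]
  have hδT : δ ^ 9 * T ^ 3 = 1 := by
    rw [hδ, ← Real.rpow_natCast, ← Real.rpow_mul hT0.le, ← Real.rpow_natCast T 3,
      ← Real.rpow_add hT0]
    norm_num
  have herr : ∀ δ', δ ≤ δ' → δ' ≤ 1 →
      |(∫ t, Real.log (‖p (torusLine a t)‖ ^ 2 + δ' ^ 2) / 2) -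
        ∫ x, Real.log (‖p x‖ ^ 2 + δ' ^ 2) / 2| ≤ E * δ := by
    intro δ' h1 h2
    have hδ'0 : 0 < δ' := hδ0.trans_le h1
    set N := ⌊T / (2 * d + 1)⌋₊ with hN
    have hN1 : (N : ℝ) ≤ T / (2 * d + 1) := Nat.floor_le (by positivity)
    have hN2 : T / (2 * d + 1) ≤ (N : ℝ) + 1 := (Nat.lt_floor_add_one _).le
    rw [le_div_iff₀ (by positivity)] at hN1
    have hNd : N * (2 * d) < T := by
      rcases Nat.eq_zero_or_pos N with h0 | h0
      · rw [h0]; simpa using hT0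
      · have : (0 : ℝ) < N := by exact_mod_cast h0
        linarith
    refine (abs_integral_log_reg_sub_le ha hd0 hB0 hδ'0 hNd hpd hpB).trans ?_
    have h3 : δ ^ 2 / (B + 1) ≤ δ' ^ 2 / (B + δ' ^ 2) := by
      have : δ' ^ 2 ≤ 1 := pow_le_one₀ hδ'0.le h2
      gcongr
    calc 6 / ((δ' ^ 2 / (B + δ' ^ 2)) ^ 4 * ((N : ℝ) + 1) ^ 3)
        ≤ 6 / ((δ ^ 2 / (B + 1)) ^ 4 * (T / (2 * d + 1)) ^ 3) := by gcongr
      _ = E * δ * (1 / (δ ^ 9 * T ^ 3)) := by rw [hE]; field_simp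
      _ = E * δ := by rw [hδT]; norm_num
  have e1 := abs_le.1 (herr δ le_rfl (by linarith))
  have e2 := abs_le.1 (herr (2 * δ) (by linarith) (by linarith))
  obtain ⟨a1, -, a3⟩ := hLa δ hδ0
  have a3 := a3 hδ2
  obtain ⟨b1, b2, -⟩ := hH δ hδ0
  obtain ⟨-, b4, -⟩ := hH (2 * δ) (by positivity)
  have hmain := abs_sub_le_of_regularized_bounds hδ0 hδ2 hq0 hq1 hD0 hE0 (by linarith) hD'0 e1 e2
    a1 a3 b1 b2 b4
  rw [← hM] at hmain
  set ℓ := Real.log (1 / δ) with hℓ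
  refine hmain.trans ?_
  have hℓle : ℓ ≤ 8 * κ * δ ^ (-(1 / 8 * κ⁻¹)) := by
    have := Real.log_le_rpow_div (x := 1 / δ) (ε := 1 / 8 * κ⁻¹) (by positivity) (by positivity)
    refine this.trans (le_of_eq ?_)
    rw [one_div δ, Real.inv_rpow hδ0.le, Real.rpow_neg hδ0.le]
    field_simp
  have hfin : δ ^ (-(1 / 8 * κ⁻¹)) * δ ^ q = T ^ (-(1 / (4 * κ))) := by
    rw [← Real.rpow_add hδ0, hδ, ← Real.rpow_mul hT0.le]
    congr 1
    rw [hq]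
    field_simp
    norm_num
  calc M * (ℓ * δ ^ q) ≤ M * (8 * κ * δ ^ (-(1 / 8 * κ⁻¹)) * δ ^ q) := by gcongr
    _ = M * (8 * κ) * (δ ^ (-(1 / 8 * κ⁻¹)) * δ ^ q) := by ring
    _ = _ := by rw [hfin]

lemma measurePreserving_torusMk (n : ℕ) :
    MeasurePreserving (torusMk (n := n)) (volume.restrict (LaurentPoly.unitCube n)) volume := by
  have h1 : (volume : Measure (Fin n → ℝ)).restrict (LaurentPoly.unitCube n) =
      Measure.pi fun _ : Fin n => (volume : Measure ℝ).restrict (Ioc 0 (0 + 1)) := by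
    rw [LaurentPoly.unitCube, volume_pi, Measure.restrict_pi_pi]
    simp_rw [restrict_Ico_eq_restrict_Ioc, zero_add]
  rw [h1]
  exact measurePreserving_pi _ _ fun _ => UnitAddCircle.measurePreserving_mk 0

namespace LaurentPoly

variable {n : ℕ} (P : LaurentPoly n)

lemma prod_expPoint_zpow (m : Fin n → ℤ) (x : Fin n → ℝ) :
    ∏ i, expPoint x i ^ m i = mFourier m (torusMk x) := by
  rw [mFourier_torusMk]
  simp only [expPoint, ← Complex.exp_int_mul]
  push_cast
  rw [← Complex.exp_sum, Finset.mul_sum]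
  congr 1
  exact Finset.sum_congr rfl fun i _ => by ring

lemma eval_expPoint (x : Fin n → ℝ) :
    P.eval (expPoint x) = trigPoly P.coeff.support P.coeff (torusMk x) := by
  rw [trigPoly_apply, eval, Finsupp.sum]
  simp only [prod_expPoint_zpow]

lemma eval_substPow_expPoint (a : Fin n → ℤ) (t : Fin 1 → ℝ) :
    (P.substPow a).eval (expPoint t) =
      trigPoly P.coeff.support P.coeff (torusLine a (torusMk t)) := by
  rw [trigPoly_apply, eval, substPow, AddMonoidAlgebra.mapDomain]
  change Finsupp.sum (Finsupp.mapDomain _ P.coeff) _ = _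
  rw [Finsupp.sum_mapDomain_index (fun _ => by simp) (fun _ _ _ => by ring), Finsupp.sum]
  simp only [prod_expPoint_zpow, mFourier_torusLine]

lemma substPow_ne_zero {a : Fin n → ℤ} (hP : P.coeff.support.Nonempty)
    (ha : InjOn (fun m : Fin n → ℤ => m ⬝ᵥ a) P.coeff.support) : P.substPow a ≠ 0 := by
  obtain ⟨m, hm⟩ := hP
  intro h
  have h1 : (P.substPow a).coeff (fun _ : Fin 1 => m ⬝ᵥ a) = P.coeff m :=
    Finsupp.mapDomain_apply' (P.coeff.support : Set (Fin n → ℤ)) P.coeff subset_rfl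
      (fun u hu v hv huv => ha hu hv (congrFun huv 0)) hm
  rw [h] at h1
  exact (Finsupp.mem_support_iff.1 hm) (by simpa using h1.symm)

end LaurentPoly

lemma integrableOn_unitCube_of_torus {n : ℕ} {f : UnitAddTorus (Fin n) → ℝ} (hf : Integrable f) :
    IntegrableOn (fun x => f (torusMk x)) (LaurentPoly.unitCube n) :=
  (measurePreserving_torusMk n).integrable_comp_of_integrable hf

lemma integral_unitCube_eq_torus {n : ℕ} {f : UnitAddTorus (Fin n) → ℝ} (hf : Integrable f) :
    ∫ x in LaurentPoly.unitCube n, f (torusMk x) = ∫ x, f x := by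
  have h := measurePreserving_torusMk n
  rw [← h.map_eq] at hf ⊢
  exact (integral_map h.measurable.aemeasurable hf.aestronglyMeasurable).symm

lemma le_norm_of_ofReal_le_rho {n : ℕ} {a : Fin n → ℤ} {T : ℝ} (h : ENNReal.ofReal T ≤ rho a ⊤)
    (ω : Fin n → ℤ) (hω : ω ≠ 0) (hωa : ω ⬝ᵥ a = 0) : T ≤ ‖ω‖ := by
  have h1 : rho a ⊤ ≤ ‖ω‖ₑ := sInf_le ⟨ω, AddSubgroup.mem_top _, hω, hωa, rfl⟩
  have h2 := h.trans h1
  rw [← ofReal_norm] at h2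
  exact (ENNReal.ofReal_le_ofReal_iff (norm_nonneg _)).1 h2

/-- For every `ε > 0` there are `C` and `R`, depending only on `n`, `P` and `ε`, such that the
estimate holds for all `a ∈ ℤⁿ` with `ρ(a; ℤⁿ) ≥ R`. That the logarithmic Mahler measures are
well defined (non-zero Laurent polynomials, convergent integrals) is part of the conclusion. -/
theorem mainTheorem7 (n k : ℕ) (P : LaurentPoly n) (hk : 2 ≤ k) (hP : P.numTerms = k)
    (ε : ℝ) (hε : 0 < ε) :
    MeasureTheory.IntegrableOn P.logAbs (LaurentPoly.unitCube n) ∧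
    ∃ C R : ℝ≥0, ∀ a : Fin n → ℤ, (R : ℝ≥0∞) ≤ rho a ⊤ →
      P.substPow a ≠ 0 ∧
      MeasureTheory.IntegrableOn (P.substPow a).logAbs (LaurentPoly.unitCube 1) ∧
      ENNReal.ofReal |(P.substPow a).logMahler - P.logMahler| ≤
        (C : ℝ≥0∞) * rho a ⊤ ^ (-(1 / (4 * ((k : ℝ) - 1))) + ε) := by
  subst hP
  obtain ⟨hint, C, R, hC, hR, h⟩ := exists_abs_integral_log_torusLine_sub_le P.coeff.support P.coeff
    (fun m hm => Finsupp.mem_support_iff.1 hm) hk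
  have hlogP : P.logAbs = fun x => Real.log ‖trigPoly P.coeff.support P.coeff (torusMk x)‖ := by
    ext x
    rw [LaurentPoly.logAbs, LaurentPoly.eval_expPoint]
  have hmP : P.logMahler = ∫ x, Real.log ‖trigPoly P.coeff.support P.coeff x‖ := by
    rw [LaurentPoly.logMahler, hlogP]
    exact integral_unitCube_eq_torus hint
  refine ⟨hlogP ▸ integrableOn_unitCube_of_torus hint, C.toNNReal, R.toNNReal, fun a ha => ?_⟩
  have hrel : ∀ T : ℝ, ENNReal.ofReal T ≤ rho a ⊤ → ∀ ω : Fin n → ℤ, ω ≠ 0 → ω ⬝ᵥ a = 0 → T ≤ ‖ω‖ :=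
    fun T hT => le_norm_of_ofReal_le_rho hT
  obtain ⟨hinj, hinta, -⟩ := h R le_rfl a (hrel R ha)
  have hloga : (P.substPow a).logAbs =
      fun t => Real.log ‖trigPoly P.coeff.support P.coeff (torusLine a (torusMk t))‖ := by
    ext t
    rw [LaurentPoly.logAbs, LaurentPoly.eval_substPow_expPoint]
  have hma : (P.substPow a).logMahler =
      ∫ t, Real.log ‖trigPoly P.coeff.support P.coeff (torusLine a t)‖ := by
    rw [LaurentPoly.logMahler, hloga]
    exact integral_unitCube_eq_torus
      (f := fun t => Real.log ‖trigPoly P.coeff.support P.coeff (torusLine a t)‖) hinta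
  refine ⟨P.substPow_ne_zero (Finset.card_pos.1 (by change 0 < P.numTerms; omega)) hinj, ?_, ?_⟩
  · rw [hloga]
    exact integrableOn_unitCube_of_torus
      (f := fun t => Real.log ‖trigPoly P.coeff.support P.coeff (torusLine a t)‖) hinta
  rw [hmP, hma]
  have hcard : ((P.coeff.support.card : ℕ) : ℝ) = (P.numTerms : ℝ) := rfl
  set κ := (P.numTerms : ℝ) - 1 with hκ
  have hκ0 : 0 < κ := by
    have : (2 : ℝ) ≤ P.numTerms := by exact_mod_cast hk
    linarith
  rw [hcard, ← hκ] at h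
  rcases eq_or_ne (rho a ⊤) ∞ with htop | htop
  · have h0 : |(∫ t, Real.log ‖trigPoly P.coeff.support P.coeff (torusLine a t)‖) -
        ∫ x, Real.log ‖trigPoly P.coeff.support P.coeff x‖| ≤ 0 := by
      have hlim : Filter.Tendsto (fun T : ℝ => C * T ^ (-(1 / (4 * κ)))) Filter.atTop (nhds 0) := by
        have := (tendsto_rpow_neg_atTop (y := 1 / (4 * κ)) (by positivity)).const_mul C
        rwa [mul_zero] at this
      refine ge_of_tendsto hlim ?_
      filter_upwards [Filter.eventually_ge_atTop R] with T hT
      exact (h T hT a (hrel T (htop ▸ le_top))).2.2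
    rw [ENNReal.ofReal_of_nonpos h0]
    exact zero_le
  · set T := (rho a ⊤).toReal with hT
    have hTρ : ENNReal.ofReal T = rho a ⊤ := ENNReal.ofReal_toReal htop
    have hRT : R ≤ T := (ENNReal.ofReal_le_iff_le_toReal htop).1 ha
    have hT1 : 1 ≤ T := hR.trans hRT
    rw [← hTρ, ENNReal.ofReal_rpow_of_pos (by linarith)]
    change _ ≤ ENNReal.ofReal C * _
    rw [← ENNReal.ofReal_mul hC]
    refine ENNReal.ofReal_le_ofReal ((h T hRT a (hrel T hTρ.le)).2.2.trans ?_)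
    gcongr
    linarith
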